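/- Let $U$ be a real-valued, real-analytic function on $\mathbb C\setminus\{0\}$ with $\sigma:=\partial\bar\partial U>0$ there, where $\partial=\frac12(\partial_x-i\partial_y)$ and $\bar\partial=\frac12(\partial_x+i\partial_y)$. For a compact simply connected domain $\mathsf D\subset\mathbb C$ (a compact set that is the closure of its simply connected interior) that contains $0$ in its interior and is bounded by a smooth simple closed curve $\gamma=\partial\mathsf D$, positively oriented, put $$t_0=\frac1{2\pi i}\oint_\gamma \partial U\,dz,\qquad t_k=\frac1{2\pi i k}\oint_\gamma z^{-k}\,\partial U\,dz\quad(k\ge1).$$ Let $J\subseteq\mathbb R$ be an open interval containing $0$, and let $\mathsf D(t)$, $t\in J$, be a smooth one-parameter deformation of $\mathsf D(0)$ through such domains: the boundary of $\mathsf D(t)$ has a regular, positively oriented, $2\pi$-periodic parametrization $\theta\mapsto\zeta(\theta,t)$, injective on $[0,2\pi)$, that is $C^\infty$ in $(\theta,t)$ jointly. The normal velocity of the boundary at the point $\zeta(\theta,t)$ is the scalar product of $\partial_t\zeta(\theta,t)$ with the outward unit normal of $\mathsf D(t)$ at that point. (i) If $t\in J$ is such that $\partial_t t_k=0$ at $t$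 for all $k\ge0$, then the normal velocity at time $t$ vanishes at every point of $\partial\mathsf D(t)$. (ii) Consequently, a deformation that preserves all the moments $t_k$, $k\ge0$, is trivial: for every $t\in J$ the normal velocity vanishes identically, and $\mathsf D(t)=\mathsf D(0)$. -/

import Mathlib

open scoped ContDiff

noncomputable section

/-- The Wirtinger derivative `∂f = (∂f/∂x - i ∂f/∂y) / 2`. -/
def wirtingerD (f : ℂ → ℂ) (z : ℂ) : ℂ :=
  (fderiv ℝ f z 1 - Complex.I * fderiv ℝ f z Complex.I) / 2

/-- The conjugate Wirtinger derivative `∂̄f = (∂f/∂x + i ∂f/∂y) / 2`. -/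
def wirtingerDBar (f : ℂ → ℂ) (z : ℂ) : ℂ :=
  (fderiv ℝ f z 1 + Complex.I * fderiv ℝ f z Complex.I) / 2

/-- The background density `σ = ∂∂̄U` of a real-valued function `U`. For a `C²` function `U` the
complex number `∂∂̄U` is real, so that its real part is all of it. -/
def backgroundDensity (U : ℂ → ℝ) (z : ℂ) : ℝ :=
  (wirtingerD (wirtingerDBar (fun w => (U w : ℂ))) z).re

/-- The contour integral `∮_γ g(z) dz` along the closed curve `γ : [0, 2π] → ℂ`. -/
def contourIntegral (γ : ℝ → ℂ) (g : ℂ → ℂ) : ℂ :=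
  ∫ θ in (0 : ℝ)..(2 * Real.pi), g (γ θ) * deriv γ θ

/-- The harmonic moments with background potential `U`, over the boundary curve `γ`:
`t₀ = (2πi)⁻¹ ∮_γ ∂U dz` and `t_k = (2πik)⁻¹ ∮_γ z^{-k} ∂U dz` for `k ≥ 1`. -/
def harmonicMoment (U : ℂ → ℝ) (γ : ℝ → ℂ) : ℕ → ℂ
  | 0 => (2 * Real.pi * Complex.I)⁻¹ *
      contourIntegral γ (fun z => wirtingerD (fun w => (U w : ℂ)) z)
  | k + 1 => (2 * Real.pi * Complex.I * ((k + 1 : ℕ) : ℂ))⁻¹ *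
      contourIntegral γ (fun z => (z ^ (k + 1))⁻¹ * wirtingerD (fun w => (U w : ℂ)) z)

/-- A compact simply connected plane domain: a compact set which is the closure of its interior,
the interior being simply connected (in particular nonempty and connected). -/
structure IsCompactSimplyConnectedDomain (D : Set ℂ) : Prop where
  isCompact : IsCompact D
  closure_interior : closure (interior D) = D
  simplyConnected : IsSimplyConnected (interior D)

/-- `γ` is a smooth regular `2π`-periodic parametrization of the boundary of `D`, which is a simple
closed curve, and `γ` goes around the interior of `D` once in the positive direction. -/
structure IsSmoothBoundaryParametrization (D : Set ℂ) (γ : ℝ → ℂ) : Prop where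
  smooth : ContDiff ℝ ∞ γ
  periodic : Function.Periodic γ (2 * Real.pi)
  injOn : Set.InjOn γ (Set.Ico 0 (2 * Real.pi))
  deriv_ne_zero : ∀ θ, deriv γ θ ≠ 0
  range_eq : Set.range γ = frontier D
  winding_eq_one : ∀ z ∈ interior D,
    (2 * Real.pi * Complex.I)⁻¹ * contourIntegral γ (fun w => (w - z)⁻¹) = 1

/-- `D t`, for `t` in `J`, is a smooth one-parameter family of compact simply connected plane
domains with smooth boundary that contain the origin in their interior; `ζ t` parametrizes the
boundary of `D t`, and `ζ` is smooth jointly in the time and in the parameter of the curve. -/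
structure IsSmoothDeformation (J : Set ℝ) (D : ℝ → Set ℂ) (ζ : ℝ → ℝ → ℂ) : Prop where
  domain : ∀ t ∈ J, IsCompactSimplyConnectedDomain (D t)
  zero_mem : ∀ t ∈ J, (0 : ℂ) ∈ interior (D t)
  boundary : ∀ t ∈ J, IsSmoothBoundaryParametrization (D t) (ζ t)
  smooth : ContDiffOn ℝ ∞ (Function.uncurry ζ) (J ×ˢ Set.univ)

/-- The unit normal `-i γ' / |γ'|`, which points outward if `γ` is positively oriented. -/
def outwardNormal (γ : ℝ → ℂ) (θ : ℝ) : ℂ :=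
  -Complex.I * deriv γ θ / (‖deriv γ θ‖ : ℂ)

/-- The normal velocity of the moving boundary `ζ t` at its point `ζ t θ`: the scalar product in
the plane of `∂ζ/∂t` with the outward unit normal. -/
def normalVelocity (ζ : ℝ → ℝ → ℂ) (t θ : ℝ) : ℝ :=
  inner ℝ (deriv (fun s => ζ s θ) t) (outwardNormal (ζ t) θ)

end

/-!
Write `ζ` for the moving boundary and `V` for its normal velocity. The transport formula
(`hasDerivAt_contourIntegral`), together with `∂̄∂U = σ` off the origin, shows that `∂ₜ t_k` is a
nonzero multiple of `∫ f ζ⁻ᵏ dθ`, where `f = σ V |∂ζ/∂θ|` is a real continuous density on the curve.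
Stationary moments therefore mean that `f` annihilates all powers `ζ⁻ᵏ`, `k ≥ 0`, and, since
`σ > 0`, the first claim says that a real density with this property is zero.

The proof of that uses the logarithmic potential `u(z) = ∫ f log |z - ζ| dθ` and its complex
derivative, the Cauchy transform of `f`. Expanding the Cauchy kernel around the origin shows that
the Cauchy transform vanishes near `0`, hence on the connected interior of the domain, so `u` is
constant there. The potential is continuous in the whole plane (`continuous_logPotential`), by a
chord-arc estimate for the curve, so it has the same constant value on the boundary. As the total
mass of `f` is zero, `u` is harmonic at infinity, and the maximum principle on the sphere
(`logPotential_le_of_eqOn_const`) makes it constant outside as well; this step does not use that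
the exterior is connected. So the Cauchy transform vanishes on both sides of the curve, and its
jump across the curve, a multiple of `f / ∂ζ/∂θ`, is zero (`density_eq_zero_of_cauchyTransform`).

For the second claim, constant moments give `V = 0` at all times. For a fixed point `p`, the minimum
of `|ζ(θ, t) - p|²` over `θ` is attained where `ζ - p` is normal to the curve, so that its time
derivative at that `θ` is zero; hence the distance from `p` to the boundary does not depend on time
(`range_subset_range_of_normalVelocity_eq_zero`), and the boundary is a fixed set. Two domains with
the same boundary whose connected interiors both contain `0` coincide.
-/

open Set Filter Topology MeasureTheory

/-! ### Parametric integrals and the chord-arc condition -/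

/-- Differentiation under the integral sign over a compact interval, for a jointly continuous
derivative. -/
theorem hasDerivAt_intervalIntegral_of_continuousOn {𝕜 E : Type*} [RCLike 𝕜]
    [NormedAddCommGroup E] [NormedSpace ℝ E] [NormedSpace 𝕜 E] {F F' : 𝕜 → ℝ → E} {V : Set 𝕜}
    (hV : IsOpen V) {a b : ℝ} {x₀ : 𝕜} (hx₀ : x₀ ∈ V)
    (hF : ∀ x ∈ V, Continuous (F x))
    (hd : ∀ x ∈ V, ∀ t, HasDerivAt (fun y => F y t) (F' x t) x)
    (hF' : ContinuousOn (Function.uncurry F') (V ×ˢ univ)) :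
    HasDerivAt (fun x => ∫ t in a..b, F x t) (∫ t in a..b, F' x₀ t) x₀ := by
  obtain ⟨r, hr, hrV⟩ := Metric.nhds_basis_closedBall.mem_iff.1 (hV.mem_nhds hx₀)
  have hK : IsCompact (Metric.closedBall x₀ r ×ˢ uIcc a b) :=
    (isCompact_closedBall x₀ r).prod isCompact_uIcc
  obtain ⟨C, hC⟩ := hK.exists_bound_of_continuousOn
    (hF'.mono (prod_mono hrV (subset_univ _)))
  have hF'₀ : Continuous (F' x₀) := by
    have : ContinuousOn (fun t : ℝ => Function.uncurry F' (x₀, t)) univ :=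
      hF'.comp (by fun_prop) (fun t _ => ⟨hx₀, mem_univ _⟩)
    simpa [continuousOn_univ] using this
  refine (intervalIntegral.hasDerivAt_integral_of_dominated_loc_of_deriv_le (F := F) (F' := F')
    (bound := fun _ => C) (Metric.closedBall_mem_nhds x₀ hr) ?_ ?_ ?_ ?_ ?_ ?_).2
  · filter_upwards [hV.mem_nhds hx₀] with x hx
    exact (hF x hx).aestronglyMeasurable
  · exact (hF x₀ hx₀).intervalIntegrable _ _
  · exact hF'₀.aestronglyMeasurable
  · exact ae_of_all _ fun t ht x hx => hC (x, t) ⟨hx, uIoc_subset_uIcc ht⟩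
  · exact intervalIntegrable_const
  · exact ae_of_all _ fun t _ x hx => hd x (hrV hx) t

theorem exists_int_of_periodic_injOn {α : Type*} {γ : ℝ → α}
    (hper : Function.Periodic γ (2 * Real.pi)) (hinj : InjOn γ (Ico 0 (2 * Real.pi))) {x y : ℝ}
    (h : γ x = γ y) : ∃ n : ℤ, y - x = n * (2 * Real.pi) := by
  have hT : 0 < 2 * Real.pi := by positivity
  have key : toIcoMod hT 0 x = toIcoMod hT 0 y := by
    refine hinj (by simpa using toIcoMod_mem_Ico hT 0 x) (by simpa using toIcoMod_mem_Ico hT 0 y) ?_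
    rw [toIcoMod, toIcoMod, hper.sub_zsmul_eq, hper.sub_zsmul_eq, h]
  obtain ⟨n, hn⟩ := (toIcoMod_eq_toIcoMod hT).1 key
  exact ⟨n, by simpa using hn⟩

/-- A regular simple closed curve satisfies a chord-arc condition. -/
theorem exists_chord_arc_const {γ : ℝ → ℂ} (hγ : ContDiff ℝ 1 γ)
    (hper : Function.Periodic γ (2 * Real.pi)) (hinj : InjOn γ (Ico 0 (2 * Real.pi)))
    (hreg : ∀ θ, deriv γ θ ≠ 0) :
    ∃ c > 0, ∀ x y, |x - y| ≤ Real.pi → c * |x - y| ≤ ‖γ x - γ y‖ := by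
  have hpi := Real.pi_pos
  -- Locally the bound comes from strict differentiability on the diagonal and from injectivity
  -- off the diagonal; compactness makes the constant uniform.
  have key : ∃ c > 0, ∀ p ∈ Icc 0 (2 * Real.pi) ×ˢ Icc (-Real.pi) (Real.pi),
      c * |p.2| ≤ ‖γ (p.1 + p.2) - γ p.1‖ := by
    refine IsCompact.induction_on (isCompact_Icc.prod isCompact_Icc)
      (p := fun s => ∃ c > 0, ∀ p ∈ s, c * |p.2| ≤ ‖γ (p.1 + p.2) - γ p.1‖) ?_ ?_ ?_ ?_
    · exact ⟨1, one_pos, by simp⟩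
    · rintro s t hst ⟨c, hc, h⟩
      exact ⟨c, hc, fun p hp => h p (hst hp)⟩
    · rintro s t ⟨c, hc, h⟩ ⟨c', hc', h'⟩
      refine ⟨min c c', lt_min hc hc', ?_⟩
      rintro p (hp | hp)
      · exact (mul_le_mul_of_nonneg_right (min_le_left _ _) (abs_nonneg _)).trans (h p hp)
      · exact (mul_le_mul_of_nonneg_right (min_le_right _ _) (abs_nonneg _)).trans (h' p hp)
    · rintro ⟨x, s⟩ ⟨hx, hs⟩
      simp only at hx hs
      suffices h : ∃ c > 0, ∀ᶠ p : ℝ × ℝ in 𝓝 (x, s), c * |p.2| ≤ ‖γ (p.1 + p.2) - γ p.1‖ by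
        obtain ⟨c, hc, h⟩ := h
        exact ⟨_, mem_nhdsWithin_of_mem_nhds h, c, hc, fun p hp => hp⟩
      by_cases hs0 : s = 0
      · subst hs0
        have hst : HasStrictDerivAt γ (deriv γ x) x :=
          hγ.contDiffAt.hasStrictDerivAt one_ne_zero
        have hn : 0 < ‖deriv γ x‖ := norm_pos_iff.2 (hreg x)
        refine ⟨‖deriv γ x‖ / 2, by positivity, ?_⟩
        have h1 := (hasStrictDerivAt_iff_hasStrictFDerivAt.1 hst).isLittleO.def
          (half_pos hn)
        have h2 : Tendsto (fun p : ℝ × ℝ => (p.1 + p.2, p.1)) (𝓝 (x, 0)) (𝓝 (x, x)) := by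
          have : Continuous (fun p : ℝ × ℝ => (p.1 + p.2, p.1)) := by fun_prop
          simpa using this.tendsto (x, 0)
        filter_upwards [h2.eventually h1] with p hp
        simp only [add_sub_cancel_left, ContinuousLinearMap.toSpanSingleton_apply,
          Real.norm_eq_abs] at hp
        have h3 : ‖p.2 • deriv γ x‖ = |p.2| * ‖deriv γ x‖ := by rw [norm_smul, Real.norm_eq_abs]
        have h4 := norm_sub_norm_le (p.2 • deriv γ x) (γ (p.1 + p.2) - γ p.1)
        rw [norm_sub_rev (p.2 • deriv γ x)] at h4
        linarith
      · have hne : γ (x + s) ≠ γ x := by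
          intro he
          obtain ⟨n, hn⟩ := exists_int_of_periodic_injOn hper hinj he.symm
          rw [add_sub_cancel_left] at hn
          have hs' : |(n : ℝ)| * (2 * Real.pi) < 1 * (2 * Real.pi) := by
            have : |s| ≤ Real.pi := abs_le.2 hs
            rw [hn, abs_mul, abs_of_pos (by positivity : 0 < 2 * Real.pi)] at this
            linarith
          have hn1 : |(n : ℝ)| < 1 := lt_of_mul_lt_mul_right hs' (by positivity)
          have hn0 : n = 0 := Int.abs_lt_one_iff.1 (by exact_mod_cast hn1)
          exact hs0 (by simp [hn, hn0])
        have hpos : 0 < ‖γ (x + s) - γ x‖ := norm_pos_iff.2 (sub_ne_zero.2 hne)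
        have hs1 : 0 < |s| := abs_pos.2 hs0
        refine ⟨‖γ (x + s) - γ x‖ / (2 * |s|), by positivity, ?_⟩
        have hcont := hγ.continuous
        have h1 : Continuous fun p : ℝ × ℝ => ‖γ (x + s) - γ x‖ / (2 * |s|) * |p.2| := by fun_prop
        have h2 : Continuous fun p : ℝ × ℝ => ‖γ (p.1 + p.2) - γ p.1‖ := by fun_prop
        refine (h1.continuousAt.eventually_lt h2.continuousAt (x₀ := (x, s)) ?_).mono
          fun p hp => hp.le
        simp only
        field_simp
        linarith
  obtain ⟨c, hc, h⟩ := key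
  refine ⟨c, hc, fun x y hxy => ?_⟩
  have hT : 0 < 2 * Real.pi := by positivity
  have h1 := h (toIcoMod hT 0 y, x - y)
    ⟨Ico_subset_Icc_self (by simpa using toIcoMod_mem_Ico hT 0 y), abs_le.1 hxy⟩
  have h2 : toIcoMod hT 0 y + (x - y) = x - toIcoDiv hT 0 y • (2 * Real.pi) := by
    rw [toIcoMod]; ring
  simp only [h2] at h1
  rwa [toIcoMod, hper.sub_zsmul_eq, hper.sub_zsmul_eq] at h1

/-- The distance of a point of the plane to a curve with a chord-arc condition is controlled from
below by the parameter distance to the parameter of a nearest point. -/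
theorem exists_nearest_param {γ : ℝ → ℂ} (hγ : Continuous γ)
    (hper : Function.Periodic γ (2 * Real.pi)) {c : ℝ}
    (hc : ∀ x y, |x - y| ≤ Real.pi → c * |x - y| ≤ ‖γ x - γ y‖) (z : ℂ) :
    ∃ a ∈ Icc 0 (2 * Real.pi), ∀ s, |s| ≤ Real.pi → c / 2 * |s| ≤ ‖z - γ (s + a)‖ := by
  have hT : 0 < 2 * Real.pi := by positivity
  obtain ⟨a, ha, hmin⟩ := isCompact_Icc.exists_isMinOn (nonempty_Icc.2 hT.le)
    (f := fun θ => ‖z - γ θ‖) (by fun_prop : Continuous fun θ => ‖z - γ θ‖).continuousOn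
  refine ⟨a, ha, fun s hs => ?_⟩
  have h1 : ‖z - γ a‖ ≤ ‖z - γ (s + a)‖ := by
    have := hmin (a := toIcoMod hT 0 (s + a))
      (Ico_subset_Icc_self (by simpa using toIcoMod_mem_Ico hT 0 (s + a)))
    simp only [mem_ofPred_eq] at this
    rwa [toIcoMod, hper.sub_zsmul_eq] at this
  have h2 := hc (s + a) a (by simpa using hs)
  rw [add_sub_cancel_right] at h2
  have h3 : ‖γ (s + a) - γ a‖ ≤ ‖z - γ a‖ + ‖z - γ (s + a)‖ := by
    have := norm_sub_le (z - γ a) (z - γ (s + a))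
    rwa [sub_sub_sub_cancel_left] at this
  linarith

theorem range_eq_image_Icc_of_periodic {γ : ℝ → ℂ} (hper : Function.Periodic γ (2 * Real.pi)) :
    range γ = γ '' Icc 0 (2 * Real.pi) := by
  have := hper.image_Icc (by positivity) 0
  rw [zero_add] at this
  exact this.symm

theorem isCompact_range_of_periodic {γ : ℝ → ℂ} (hγ : Continuous γ)
    (hper : Function.Periodic γ (2 * Real.pi)) : IsCompact (range γ) := by
  rw [range_eq_image_Icc_of_periodic hper]
  exact isCompact_Icc.image hγ

/-! ### Logarithmic potentials and Cauchy transforms -/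

/-- The logarithmic potential of the real density `f` on the closed curve `γ`, as a density with
respect to the parameter of the curve. -/
noncomputable def logPotential (f : ℝ → ℝ) (γ : ℝ → ℂ) (z : ℂ) : ℝ :=
  ∫ θ in (0 : ℝ)..(2 * Real.pi), f θ * Real.log ‖z - γ θ‖

/-- The Cauchy transform of the real density `f` on the closed curve `γ`, with the sign for which it
is the complex derivative of the logarithmic potential. -/
noncomputable def cauchyTransform (f : ℝ → ℝ) (γ : ℝ → ℂ) (z : ℂ) : ℂ :=
  ∫ θ in (0 : ℝ)..(2 * Real.pi), (f θ : ℂ) / (z - γ θ)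

theorem hasDerivAt_integral_log_one_add {f : ℝ → ℝ} {q : ℝ → ℂ} (hf : Continuous f)
    (hq : Continuous q) {Q : ℝ} (hQ : ∀ θ, ‖q θ‖ ≤ Q) {a b : ℝ} {w : ℂ} (hw : ‖w‖ * Q < 1) :
    HasDerivAt (fun w => ∫ θ in a..b, (f θ : ℂ) * Complex.log (1 + w * q θ))
      (∫ θ in a..b, (f θ : ℂ) * (q θ / (1 + w * q θ))) w := by
  have hslit : ∀ w ∈ {w : ℂ | ‖w‖ * Q < 1}, ∀ θ, 1 + w * q θ ∈ Complex.slitPlane := by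
    intro w hw θ
    refine Complex.mem_slitPlane_of_norm_lt_one ?_
    rw [norm_mul]
    exact (mul_le_mul_of_nonneg_left (hQ θ) (norm_nonneg _)).trans_lt hw
  refine hasDerivAt_intervalIntegral_of_continuousOn (E := ℂ)
    (F := fun w θ => (f θ : ℂ) * Complex.log (1 + w * q θ))
    (F' := fun w θ => (f θ : ℂ) * (q θ / (1 + w * q θ))) (V := {w : ℂ | ‖w‖ * Q < 1})
    (isOpen_lt (by fun_prop) continuous_const) hw ?_ ?_ ?_
  · intro w hw
    refine (Complex.continuous_ofReal.comp hf).mul ?_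
    exact Continuous.clog (by fun_prop) (hslit w hw)
  · intro w hw θ
    have h1 : HasDerivAt (fun w : ℂ => 1 + w * q θ) (q θ) w := by
      simpa using ((hasDerivAt_id w).mul_const (q θ)).const_add 1
    exact (h1.clog (hslit w hw θ)).const_mul _
  · refine ContinuousOn.mul (by fun_prop) (ContinuousOn.div (by fun_prop) (by fun_prop) ?_)
    rintro ⟨w, θ⟩ ⟨hw, -⟩
    exact Complex.slitPlane_ne_zero (hslit w hw θ)

theorem re_integral_log_one_add {f : ℝ → ℝ} {q : ℝ → ℂ} (hf : Continuous f)
    (hq : Continuous q) {Q : ℝ} (hQ : ∀ θ, ‖q θ‖ ≤ Q) {a b : ℝ} {w : ℂ} (hw : ‖w‖ * Q < 1) :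
    (∫ θ in a..b, (f θ : ℂ) * Complex.log (1 + w * q θ)).re =
      ∫ θ in a..b, f θ * Real.log ‖1 + w * q θ‖ := by
  have hint : IntervalIntegrable (fun θ => (f θ : ℂ) * Complex.log (1 + w * q θ)) volume a b := by
    refine Continuous.intervalIntegrable ?_ _ _
    refine (Complex.continuous_ofReal.comp hf).mul (Continuous.clog (by fun_prop) fun θ => ?_)
    refine Complex.mem_slitPlane_of_norm_lt_one ?_
    rw [norm_mul]
    exact (mul_le_mul_of_nonneg_left (hQ θ) (norm_nonneg _)).trans_lt hw
  have := Complex.reCLM.intervalIntegral_comp_comm hint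
  simp only [Complex.reCLM_apply, Complex.re_ofReal_mul, Complex.log_re] at this
  exact this.symm

/-- Off the curve the logarithmic potential is locally, up to a constant, the real part of a
holomorphic primitive of the Cauchy transform. -/
theorem exists_local_primitive {f : ℝ → ℝ} {γ : ℝ → ℂ} (hf : Continuous f) (hγ : Continuous γ)
    (hper : Function.Periodic γ (2 * Real.pi)) {z₀ : ℂ} (hz₀ : z₀ ∉ range γ) :
    ∃ F : ℂ → ℂ, ∀ᶠ z in 𝓝 z₀, HasDerivAt F (cauchyTransform f γ z) z ∧
      logPotential f γ z = logPotential f γ z₀ + (F z).re := by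
  have hcl : IsClosed (range γ) := (isCompact_range_of_periodic hγ hper).isClosed
  obtain ⟨r, hr, hball⟩ := Metric.isOpen_iff.1 hcl.isOpen_compl z₀ hz₀
  have hne : ∀ z ∈ Metric.ball z₀ r, ∀ θ, z - γ θ ≠ 0 := fun z hz θ h =>
    hball hz ⟨θ, (sub_eq_zero.1 h).symm⟩
  have hne₀ := hne z₀ (Metric.mem_ball_self hr)
  have hdist : ∀ θ, r ≤ ‖z₀ - γ θ‖ := by
    intro θ
    by_contra! h
    refine hball (a := γ θ) ?_ ⟨θ, rfl⟩
    rwa [Metric.mem_ball, dist_comm, dist_eq_norm]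
  have hq : Continuous fun θ => (z₀ - γ θ)⁻¹ := Continuous.inv₀ (by fun_prop) hne₀
  have hQ : ∀ θ, ‖(z₀ - γ θ)⁻¹‖ ≤ r⁻¹ := fun θ => by
    rw [norm_inv]; exact inv_anti₀ hr (hdist θ)
  refine ⟨fun z => ∫ θ in (0 : ℝ)..(2 * Real.pi),
    (f θ : ℂ) * Complex.log (1 + (z - z₀) * (z₀ - γ θ)⁻¹), ?_⟩
  filter_upwards [Metric.ball_mem_nhds z₀ hr] with z hz
  have hw : ‖z - z₀‖ * r⁻¹ < 1 := by
    rw [← div_eq_mul_inv, div_lt_one hr, ← dist_eq_norm]; exact hz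
  have heq : ∀ θ, 1 + (z - z₀) * (z₀ - γ θ)⁻¹ = (z - γ θ) / (z₀ - γ θ) := fun θ => by
    field_simp [hne₀ θ]; ring
  constructor
  · have h := HasDerivAt.comp_sub_const z z₀
      (hasDerivAt_integral_log_one_add (a := 0) (b := 2 * Real.pi) hf hq hQ hw)
    have hC : cauchyTransform f γ z = ∫ θ in (0 : ℝ)..(2 * Real.pi),
        (f θ : ℂ) * ((z₀ - γ θ)⁻¹ / (1 + (z - z₀) * (z₀ - γ θ)⁻¹)) := by
      refine intervalIntegral.integral_congr fun θ _ => ?_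
      simp only [heq]
      field_simp [hne₀ θ, hne z hz θ]
    rw [hC]
    exact h
  · rw [re_integral_log_one_add hf hq hQ hw, logPotential, logPotential,
      ← intervalIntegral.integral_add]
    · refine intervalIntegral.integral_congr fun θ _ => ?_
      simp only [heq, norm_div]
      rw [Real.log_div (norm_ne_zero_iff.2 (hne z hz θ)) (norm_ne_zero_iff.2 (hne₀ θ))]
      ring
    · refine Continuous.intervalIntegrable ?_ _ _
      exact hf.mul (Continuous.log (by fun_prop) fun θ => norm_ne_zero_iff.2 (hne₀ θ))
    · refine Continuous.intervalIntegrable ?_ _ _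
      refine hf.mul (Continuous.log (by fun_prop) fun θ => norm_ne_zero_iff.2 ?_)
      rw [heq]
      exact div_ne_zero (hne z hz θ) (hne₀ θ)

theorem differentiableAt_cauchyTransform {f : ℝ → ℝ} {γ : ℝ → ℂ} (hf : Continuous f)
    (hγ : Continuous γ) (hper : Function.Periodic γ (2 * Real.pi)) {z₀ : ℂ} (hz₀ : z₀ ∉ range γ) :
    DifferentiableAt ℂ (cauchyTransform f γ) z₀ := by
  obtain ⟨F, hF⟩ := exists_local_primitive hf hγ hper hz₀
  have h1 : AnalyticAt ℂ F z₀ := Complex.analyticAt_iff_eventually_differentiableAt.2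
    (hF.mono fun z hz => hz.1.differentiableAt)
  refine h1.deriv.differentiableAt.congr_of_eventuallyEq ?_
  exact hF.mono fun z hz => hz.1.deriv.symm

theorem hasFDerivAt_logPotential {f : ℝ → ℝ} {γ : ℝ → ℂ} (hf : Continuous f)
    (hγ : Continuous γ) (hper : Function.Periodic γ (2 * Real.pi)) {z₀ : ℂ} (hz₀ : z₀ ∉ range γ) :
    HasFDerivAt (logPotential f γ) (Complex.reCLM ∘L
      (ContinuousLinearMap.toSpanSingleton ℂ (cauchyTransform f γ z₀)).restrictScalars ℝ) z₀ := by
  obtain ⟨F, hF⟩ := exists_local_primitive hf hγ hper hz₀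
  have h1 := (hF.self_of_nhds.1.hasFDerivAt.restrictScalars ℝ)
  have h2 := (Complex.reCLM.hasFDerivAt.comp z₀ h1).const_add (logPotential f γ z₀)
  exact h2.congr_of_eventuallyEq (hF.mono fun z hz => hz.2)

/-- The logarithmic potential of a continuous density is continuous in the whole plane. -/
theorem continuous_logPotential {f : ℝ → ℝ} {γ : ℝ → ℂ} (hf : Continuous f)
    (hfper : Function.Periodic f (2 * Real.pi)) (hγ : Continuous γ)
    (hper : Function.Periodic γ (2 * Real.pi)) {c : ℝ} (hc0 : 0 < c)
    (hc : ∀ x y, |x - y| ≤ Real.pi → c * |x - y| ≤ ‖γ x - γ y‖) :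
    Continuous (logPotential f γ) := by
  have hpi := Real.pi_pos
  have hshift : ∀ z a, logPotential f γ z =
      ∫ s in (-Real.pi)..Real.pi, f (s + a) * Real.log ‖z - γ (s + a)‖ := by
    intro z a
    have hp : Function.Periodic (fun θ => f θ * Real.log ‖z - γ θ‖) (2 * Real.pi) := fun θ => by
      simp only [hfper θ, hper θ]
    have := hp.intervalIntegral_add_eq 0 (-Real.pi + a)
    rw [zero_add] at this
    rw [logPotential, this, intervalIntegral.integral_comp_add_right
      (fun θ => f θ * Real.log ‖z - γ θ‖)]
    congr 1; ring
  refine continuous_iff_continuousAt.2 fun z => ?_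
  refine tendsto_of_seq_tendsto fun x hx => tendsto_of_subseq_tendsto fun ns hns => ?_
  choose a haI ha using exists_nearest_param hγ hper hc
  -- Shifting the parameter by that of a nearest point gives a common dominating function; along a
  -- subsequence the shifts converge.
  obtain ⟨α, hα, φ, hφ, hlim⟩ := isCompact_Icc.tendsto_subseq (fun n => haI (x (ns n)))
  refine ⟨φ, ?_⟩
  have hz : Tendsto (fun n => x (ns (φ n))) atTop (𝓝 z) :=
    hx.comp (hns.comp hφ.tendsto_atTop)
  obtain ⟨B, hB⟩ : ∃ B, ∀ θ, |f θ| ≤ B := by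
    obtain ⟨B, hB⟩ := (hfper.compact_of_continuous (by positivity) hf).isBounded.exists_norm_le
    exact ⟨B, fun θ => hB _ (mem_range_self θ)⟩
  obtain ⟨R, hR⟩ : ∃ R, ∀ n θ, ‖x (ns (φ n)) - γ θ‖ ≤ R := by
    obtain ⟨R₁, hR₁⟩ := (isCompact_range_of_periodic hγ hper).isBounded.exists_norm_le
    obtain ⟨R₂, hR₂⟩ := (Metric.isBounded_range_of_tendsto _ hz).exists_norm_le
    exact ⟨R₂ + R₁, fun n θ => (norm_sub_le _ _).trans
      (add_le_add (hR₂ _ (mem_range_self n)) (hR₁ _ (mem_range_self θ)))⟩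
  have hptwise : ∀ s, Tendsto (fun n => ‖x (ns (φ n)) - γ (s + a (x (ns (φ n))))‖) atTop
      (𝓝 ‖z - γ (s + α)‖) := fun s =>
    (hz.sub ((hγ.tendsto _).comp (tendsto_const_nhds.add hlim))).norm
  have hlow : ∀ s, |s| ≤ Real.pi → c / 2 * |s| ≤ ‖z - γ (s + α)‖ := fun s hs =>
    ge_of_tendsto' (hptwise s) fun n => ha _ s hs
  have hmain : Tendsto (fun n => ∫ s in (-Real.pi)..Real.pi, f (s + a (x (ns (φ n)))) *
      Real.log ‖x (ns (φ n)) - γ (s + a (x (ns (φ n))))‖) atTop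
      (𝓝 (∫ s in (-Real.pi)..Real.pi, f (s + α) * Real.log ‖z - γ (s + α)‖)) := by
    refine intervalIntegral.tendsto_integral_filter_of_dominated_convergence
      (fun s => B * (|Real.log (c / 2)| + |Real.log s| + |Real.log R|)) ?_ ?_ ?_ ?_
    · refine Eventually.of_forall fun n => Measurable.aestronglyMeasurable ?_
      have := hf.measurable
      have := hγ.measurable
      fun_prop
    · refine Eventually.of_forall fun n => ?_
      have h0 : ∀ᵐ s : ℝ, s ≠ 0 := by simp [ae_iff]
      filter_upwards [h0] with s hs0 hs
      have hs' : |s| ≤ Real.pi := by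
        rw [uIoc_of_le (by linarith)] at hs
        exact abs_le.2 ⟨hs.1.le, hs.2⟩
      have h1 := ha (x (ns (φ n))) s hs'
      have h2 := hR n (s + a (x (ns (φ n))))
      have hpos : 0 < c / 2 * |s| := by have := abs_pos.2 hs0; positivity
      have h3 := Real.log_le_log hpos h1
      have h4 := Real.log_le_log (hpos.trans_le h1) h2
      rw [Real.log_mul (by positivity) (abs_pos.2 hs0).ne', Real.log_abs] at h3
      rw [norm_mul]
      refine mul_le_mul (hB _) ?_ (norm_nonneg _) ((abs_nonneg _).trans (hB 0))
      rw [Real.norm_eq_abs, abs_le]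
      have e1 := neg_abs_le (Real.log (c / 2))
      have e2 := neg_abs_le (Real.log s)
      have e3 := le_abs_self (Real.log R)
      have e4 := abs_nonneg (Real.log (c / 2))
      have e5 := abs_nonneg (Real.log s)
      have e6 := abs_nonneg (Real.log R)
      constructor <;> linarith
    · refine IntervalIntegrable.const_mul ?_ B
      exact (intervalIntegrable_const.add
        intervalIntegral.intervalIntegrable_log'.abs).add intervalIntegrable_const
    · have h0 : ∀ᵐ s : ℝ, s ≠ 0 := by simp [ae_iff]
      filter_upwards [h0] with s hs0 hs
      have hs' : |s| ≤ Real.pi := by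
        rw [uIoc_of_le (by linarith)] at hs
        exact abs_le.2 ⟨hs.1.le, hs.2⟩
      have hpos : 0 < c / 2 * |s| := by have := abs_pos.2 hs0; positivity
      exact ((hf.tendsto _).comp (tendsto_const_nhds.add hlim)).mul
        ((hptwise s).log (hpos.trans_le (hlow s hs')).ne')
  rw [hshift z α]
  exact hmain.congr fun n => (hshift _ _).symm

/-- If the moments of nonpositive degree of a density vanish, so does its Cauchy transform near the
origin, by the expansion of the Cauchy kernel into a geometric series. -/
theorem cauchyTransform_eventually_eq_zero {f : ℝ → ℝ} {γ : ℝ → ℂ} (hf : Continuous f)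
    (hγ : Continuous γ) {r : ℝ} (hr : 0 < r) (hγr : ∀ θ, r ≤ ‖γ θ‖)
    (hmom : ∀ k : ℕ, ∫ θ in (0 : ℝ)..(2 * Real.pi), (f θ : ℂ) * (γ θ ^ k)⁻¹ = 0) :
    ∀ᶠ z in 𝓝 0, cauchyTransform f γ z = 0 := by
  filter_upwards [Metric.ball_mem_nhds (0 : ℂ) hr] with z hz
  rw [mem_ball_zero_iff] at hz
  have hγ0 : ∀ θ, γ θ ≠ 0 := fun θ => norm_pos_iff.1 (hr.trans_le (hγr θ))
  have hlt : ∀ θ, ‖z / γ θ‖ ≤ ‖z‖ / r := fun θ => by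
    rw [norm_div]; exact div_le_div_of_nonneg_left (norm_nonneg _) hr (hγr θ)
  have hlt1 : ‖z‖ / r < 1 := (div_lt_one hr).2 hz
  have hs : HasSum (fun n : ℕ => ∫ θ in (0 : ℝ)..(2 * Real.pi),
      -(f θ : ℂ) / γ θ * (z / γ θ) ^ n) (cauchyTransform f γ z) := by
    obtain ⟨B, hB⟩ := (isCompact_uIcc (a := 0) (b := 2 * Real.pi)).exists_bound_of_continuousOn
      hf.continuousOn
    refine intervalIntegral.hasSum_integral_of_dominated_convergence
      (fun n _ => B / r * (‖z‖ / r) ^ n) ?_ ?_ ?_ ?_ ?_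
    · intro n
      refine Continuous.aestronglyMeasurable ?_
      exact (Continuous.div (by fun_prop) hγ hγ0).mul ((Continuous.div (by fun_prop) hγ hγ0).pow n)
    · refine fun n => ae_of_all _ fun θ hθ => ?_
      rw [norm_mul, norm_pow, norm_div, norm_neg, Complex.norm_real]
      have hBθ := hB θ (uIoc_subset_uIcc hθ)
      have hB0 : 0 ≤ B := (norm_nonneg _).trans hBθ
      have hγθ := hγr θ
      have hltθ := hlt θ
      gcongr
    · exact ae_of_all _ fun θ _ => (summable_geometric_of_lt_one (by positivity) hlt1).mul_left _
    · exact intervalIntegrable_const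
    · refine ae_of_all _ fun θ _ => ?_
      have h1 := (hasSum_geometric_of_norm_lt_one ((hlt θ).trans_lt hlt1)).mul_left
        (-(f θ : ℂ) / γ θ)
      have h2 : z - γ θ ≠ 0 := by
        intro h
        rw [sub_eq_zero] at h
        exact (hz.trans_le (hγr θ)).ne (by rw [h])
      have h3 : γ θ - z ≠ 0 := by rw [← neg_sub]; exact neg_ne_zero.2 h2
      have h4 : (1 - z / γ θ) = (γ θ - z) / γ θ := by rw [sub_div, div_self (hγ0 θ)]
      have h5 : -(f θ : ℂ) / γ θ * (1 - z / γ θ)⁻¹ = (f θ : ℂ) / (z - γ θ) := by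
        rw [h4, inv_div, div_mul_div_cancel₀ (hγ0 θ), ← neg_sub (γ θ) z, div_neg, neg_div]
      rwa [h5] at h1
  refine hs.unique ?_
  convert hasSum_zero with n
  have : ∀ θ, -(f θ : ℂ) / γ θ * (z / γ θ) ^ n = -z ^ n * ((f θ : ℂ) * (γ θ ^ (n + 1))⁻¹) := by
    intro θ
    have := hγ0 θ
    rw [div_pow]
    field_simp
    ring
  simp only [this]
  rw [intervalIntegral.integral_const_mul, hmom, mul_zero]

/-! ### The potential at infinity and the maximum principle -/

/-- The logarithmic potential near infinity, for a density of total mass zero, is the real part of a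
function of `1 / z` which is holomorphic near zero and vanishes there. -/
theorem exists_primitive_at_infinity {f : ℝ → ℝ} {γ : ℝ → ℂ} (hf : Continuous f)
    (hγ : Continuous γ) (hper : Function.Periodic γ (2 * Real.pi))
    (hmass : ∫ θ in (0 : ℝ)..(2 * Real.pi), f θ = 0) :
    ∃ F : ℂ → ℂ, F 0 = 0 ∧ ∀ᶠ w in 𝓝 0, DifferentiableAt ℂ F w ∧
      (w ≠ 0 → logPotential f γ w⁻¹ = (F w).re) := by
  obtain ⟨Q, hQ⟩ := (isCompact_range_of_periodic hγ hper).isBounded.exists_norm_le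
  have hQ' : ∀ θ, ‖-γ θ‖ ≤ Q := fun θ => by rw [norm_neg]; exact hQ _ (mem_range_self θ)
  refine ⟨fun w => ∫ θ in (0 : ℝ)..(2 * Real.pi), (f θ : ℂ) * Complex.log (1 + w * -γ θ), by simp,
    ?_⟩
  have hev : ∀ᶠ w : ℂ in 𝓝 0, ‖w‖ * Q < 1 :=
    (by fun_prop : Continuous fun w : ℂ => ‖w‖ * Q).continuousAt.eventually_lt
      continuousAt_const (by simp)
  filter_upwards [hev] with w hw
  refine ⟨(hasDerivAt_integral_log_one_add hf hγ.neg hQ' hw).differentiableAt, fun hw0 => ?_⟩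
  have hne : ∀ θ, 1 + w * -γ θ ≠ 0 := fun θ => by
    refine Complex.slitPlane_ne_zero (Complex.mem_slitPlane_of_norm_lt_one ?_)
    rw [norm_mul]
    exact (mul_le_mul_of_nonneg_left (hQ' θ) (norm_nonneg _)).trans_lt hw
  have hnorm : ∀ θ, Real.log ‖w⁻¹ - γ θ‖ = Real.log ‖1 + w * -γ θ‖ - Real.log ‖w‖ := fun θ => by
    rw [← Real.log_div (norm_ne_zero_iff.2 (hne θ)) (norm_ne_zero_iff.2 hw0), ← norm_div]
    congr 2
    field_simp
    ring
  rw [re_integral_log_one_add hf (q := fun θ => -γ θ) hγ.neg hQ' hw, logPotential]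
  simp only [hnorm, mul_sub]
  rw [intervalIntegral.integral_sub, intervalIntegral.integral_mul_const, hmass, zero_mul, sub_zero]
  · refine Continuous.intervalIntegrable ?_ _ _
    exact hf.mul (Continuous.log (by fun_prop) fun θ => norm_ne_zero_iff.2 (hne θ))
  · exact Continuous.intervalIntegrable (by fun_prop) _ _

theorem eventually_re_eq_of_isLocalMax_re {F : ℂ → ℂ} {z₀ : ℂ}
    (hd : ∀ᶠ z in 𝓝 z₀, DifferentiableAt ℂ F z) (hmax : ∀ᶠ z in 𝓝 z₀, (F z).re ≤ (F z₀).re) :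
    ∀ᶠ z in 𝓝 z₀, (F z).re = (F z₀).re := by
  have h := Complex.norm_eventually_eq_of_isLocalMax (f := fun z => Complex.exp (F z)) (c := z₀)
    (hd.mono fun z hz => hz.cexp) ?_
  · filter_upwards [h] with z hz
    simpa [Complex.norm_exp] using hz
  · filter_upwards [hmax] with z hz
    simpa [Complex.norm_exp] using hz

/-- Maximum principle on the sphere: a continuous logarithmic potential of total mass zero which is
constant on a nonempty set that contains the curve does not exceed that constant. -/
theorem logPotential_le_of_eqOn_const {f : ℝ → ℝ} {γ : ℝ → ℂ} (hf : Continuous f)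
    (hγ : Continuous γ) (hper : Function.Periodic γ (2 * Real.pi))
    (hu : Continuous (logPotential f γ))
    (hmass : ∫ θ in (0 : ℝ)..(2 * Real.pi), f θ = 0) {D : Set ℂ} (hD : range γ ⊆ D) {κ : ℝ}
    (hκ : ∀ z ∈ D, logPotential f γ z = κ) (z : ℂ) : logPotential f γ z ≤ κ := by
  by_contra! hz
  set u := logPotential f γ with hu_def
  obtain ⟨F, hF0, hF⟩ := exists_primitive_at_infinity hf hγ hper hmass
  -- A finite global maximum above `κ` would be attained on an open and closed set.
  have hnomax : ¬ ∃ x, κ < u x ∧ ∀ y, u y ≤ u x := by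
    rintro ⟨x, hx, hmax⟩
    have hopen : IsOpen {y | u y = u x} := by
      refine isOpen_iff_mem_nhds.2 fun y hy => ?_
      have hy' : u y = u x := hy
      have hyD : y ∉ range γ := fun h => by
        have := hκ y (hD h)
        rw [hy'] at this
        exact hx.ne' this
      obtain ⟨G, hG⟩ := exists_local_primitive hf hγ hper hyD
      have hGy := hG.self_of_nhds.2
      have h1 := eventually_re_eq_of_isLocalMax_re (hG.mono fun w hw => hw.1.differentiableAt)
        (hG.mono fun w hw => by
          have h2 := hw.2
          have h3 := hmax w
          rw [hu_def] at h3 hy'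
          linarith)
      filter_upwards [hG, h1] with w hw hw1
      have h2 := hw.2
      change logPotential f γ w = u x
      rw [hu_def] at hy' ⊢
      linarith
    have hclopen : IsClopen {y | u y = u x} := ⟨isClosed_eq hu continuous_const, hopen⟩
    have huniv := hclopen.eq_univ ⟨x, rfl⟩
    have h0 : γ 0 ∈ {y | u y = u x} := huniv ▸ mem_univ _
    have h0' : u (γ 0) = u x := h0
    rw [hκ _ (hD (mem_range_self 0))] at h0'
    exact hx.ne h0'
  have hFc : Tendsto (fun w => (F w).re) (𝓝 0) (𝓝 0) := by
    have := (Complex.continuous_re.continuousAt).comp (f := F)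
      hF.self_of_nhds.1.continuousAt
    simpa [ContinuousAt, hF0, Function.comp_def] using this
  have hle : ∀ y, u y ≤ 0 := by
    intro y
    by_contra! hy
    have hev : ∀ᶠ w in 𝓝[≠] (0 : ℂ), u w⁻¹ < u y := by
      filter_upwards [(hFc.eventually_lt_const hy).filter_mono nhdsWithin_le_nhds,
        hF.filter_mono nhdsWithin_le_nhds, self_mem_nhdsWithin] with w h1 h2 h3
      rwa [hu_def, h2.2 h3]
    have hinv := (tendsto_inv₀_cobounded' (α := ℂ)).eventually hev
    obtain ⟨x, hx⟩ := hu.exists_forall_ge' y (by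
      rw [← Metric.cobounded_eq_cocompact]
      filter_upwards [hinv] with y hy
      rw [inv_inv] at hy
      exact hy.le)
    exact hnomax ⟨x, hz.trans_le (hx z), hx⟩
  -- Now `u ≤ 0`, so that the maximum is attained at infinity, hence also near it.
  have h1 := eventually_re_eq_of_isLocalMax_re (F := F) (z₀ := 0) (hF.mono fun w hw => hw.1) (by
    filter_upwards [hF] with w hw
    by_cases hw0 : w = 0
    · rw [hw0]
    · rw [hF0, ← hw.2 hw0]
      exact hle _)
  obtain ⟨w, ⟨hw1, hw2⟩, hw0⟩ := (((h1.and hF).filter_mono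
    (nhdsWithin_le_nhds (s := {0}ᶜ))).and self_mem_nhdsWithin).exists
  have h2 : u w⁻¹ = 0 := by rw [hu_def, hw2.2 hw0, hw1, hF0, Complex.zero_re]
  exact hnomax ⟨w⁻¹, by rw [h2]; linarith [hle z], fun y => by rw [h2]; exact hle y⟩

/-- If all moments of nonpositive degree of a real density on the boundary of a domain around the
origin vanish, so does its Cauchy transform off the boundary. In the domain this is the
identity theorem; outside it follows from the maximum principle for the logarithmic potential, which
has become constant on the domain and, by continuity, on its boundary. -/
theorem cauchyTransform_eq_zero_of_moments {f : ℝ → ℝ} {γ : ℝ → ℂ} {D : Set ℂ} (hf : Continuous f)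
    (hfper : Function.Periodic f (2 * Real.pi)) (hγ : Continuous γ)
    (hper : Function.Periodic γ (2 * Real.pi)) {c : ℝ} (hc0 : 0 < c)
    (hc : ∀ x y, |x - y| ≤ Real.pi → c * |x - y| ≤ ‖γ x - γ y‖)
    (hDclosed : closure (interior D) = D) (hDconn : IsPreconnected (interior D))
    (h0 : (0 : ℂ) ∈ interior D) (hrange : range γ = frontier D)
    (hmom : ∀ k : ℕ, ∫ θ in (0 : ℝ)..(2 * Real.pi), (f θ : ℂ) * (γ θ ^ k)⁻¹ = 0) {z : ℂ}
    (hz : z ∉ range γ) : cauchyTransform f γ z = 0 := by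
  have hint : ∀ w ∈ interior D, w ∉ range γ := fun w hw h => by
    rw [hrange] at h; exact h.2 hw
  obtain ⟨r, hr, hball⟩ := Metric.isOpen_iff.1 isOpen_interior _ h0
  have hγr : ∀ θ, r ≤ ‖γ θ‖ := fun θ => by
    by_contra! h
    exact hint _ (hball (mem_ball_zero_iff.2 h)) (mem_range_self θ)
  have hmass : ∫ θ in (0 : ℝ)..(2 * Real.pi), f θ = 0 := by
    have := hmom 0
    simp only [pow_zero, inv_one, mul_one] at this
    rw [intervalIntegral.integral_ofReal] at this
    exact_mod_cast this
  have hu := continuous_logPotential hf hfper hγ hper hc0 hc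
  have hC : EqOn (cauchyTransform f γ) 0 (interior D) := by
    have han : AnalyticOnNhd ℂ (cauchyTransform f γ) (interior D) :=
      DifferentiableOn.analyticOnNhd (fun w hw =>
        (differentiableAt_cauchyTransform hf hγ hper (hint w hw)).differentiableWithinAt)
        isOpen_interior
    exact han.eqOn_zero_of_preconnected_of_eventuallyEq_zero hDconn h0
      (cauchyTransform_eventually_eq_zero hf hγ hr hγr hmom)
  have hconst : ∀ w ∈ interior D, logPotential f γ w = logPotential f γ 0 := by
    intro w hw
    refine isOpen_interior.is_const_of_fderiv_eq_zero (𝕜 := ℝ) (f := logPotential f γ) hDconn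
      (fun x hx =>
      (hasFDerivAt_logPotential hf hγ hper (hint x hx)).differentiableAt.differentiableWithinAt)
      (fun x hx => ?_) hw h0
    rw [(hasFDerivAt_logPotential hf hγ hper (hint x hx)).fderiv, hC hx]
    ext v
    simp
  have hconst' : ∀ w ∈ D, logPotential f γ w = logPotential f γ 0 := by
    intro w hw
    rw [← hDclosed] at hw
    exact closure_minimal hconst (isClosed_eq hu continuous_const) hw
  have hD : range γ ⊆ D := by
    rw [hrange]
    exact IsClosed.frontier_subset (hDclosed ▸ isClosed_closure)
  have hneg : ∀ w, logPotential (fun θ => -f θ) γ w = -logPotential f γ w := fun w => by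
    simp only [logPotential, neg_mul]
    rw [intervalIntegral.integral_neg]
  have hall : ∀ w, logPotential f γ w = logPotential f γ 0 := by
    intro w
    refine le_antisymm (logPotential_le_of_eqOn_const hf hγ hper hu hmass hD hconst' w) ?_
    have := logPotential_le_of_eqOn_const (f := fun θ => -f θ) (κ := -logPotential f γ 0) hf.neg hγ
      hper ?_ ?_ hD (fun w hw => by rw [hneg, hconst' w hw]) w
    · rw [hneg] at this
      linarith
    · rw [funext hneg]; exact hu.neg
    · rw [intervalIntegral.integral_neg, hmass, neg_zero]
  have h1 := hasFDerivAt_logPotential hf hγ hper hz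
  rw [funext hall] at h1
  have h2 := h1.unique (hasFDerivAt_const (logPotential f γ 0) z)
  have h3 := DFunLike.congr_fun h2 1
  have h4 := DFunLike.congr_fun h2 Complex.I
  simp at h3 h4
  exact Complex.ext h3 h4

/-! ### The jump of the Cauchy transform -/

/-- Points on the normal of a regular curve at a distance comparable to `ε` from the base point
keep a distance comparable to `ε + |h|` from the point of the curve with parameter offset `h`. -/
theorem exists_normal_separation {γ : ℝ → ℂ} {c : ℝ} (hc0 : 0 < c)
    (hc : ∀ x y, |x - y| ≤ Real.pi → c * |x - y| ≤ ‖γ x - γ y‖) {θ₀ : ℝ} {v : ℂ} (hv : v ≠ 0)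
    (hd : HasDerivAt γ v θ₀) :
    ∃ m > 0, ∃ ε₀ > 0, ∀ ε : ℝ, 0 < ε → ε < ε₀ → ∀ h : ℝ, |h| ≤ Real.pi →
      m * (ε + |h|) ≤ ‖ε * (Complex.I * v) - (γ (θ₀ + h) - γ θ₀)‖ ∧
      m * (ε + |h|) ≤ ‖ε * (Complex.I * v) + (γ (θ₀ + h) - γ θ₀)‖ := by
  have hv' : 0 < ‖v‖ := norm_pos_iff.2 hv
  have hlo := (hasDerivAt_iff_isLittleO_nhds_zero.1 hd).def (by positivity : 0 < ‖v‖ / 4)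
  obtain ⟨η, hη, hnear⟩ := Metric.eventually_nhds_iff.1 hlo
  refine ⟨min (c / 2) (‖v‖ / 4), by positivity, c * η / 2 / (‖v‖ + c / 2), by positivity, ?_⟩
  intro ε hε hε₀ h hh
  set d := γ (θ₀ + h) - γ θ₀ with hd_def
  have hεv : ‖(ε : ℂ) * (Complex.I * v)‖ = ε * ‖v‖ := by
    rw [norm_mul, norm_mul, Complex.norm_I, one_mul, Complex.norm_real, Real.norm_of_nonneg hε.le]
  have hh0 := abs_nonneg h
  by_cases hsmall : |h| < η
  · have h1 : ‖d - h * v‖ ≤ ‖v‖ / 4 * |h| := by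
      have := hnear (y := h) (by simpa using hsmall)
      simpa [hd_def] using this
    -- The vectors `ε i v` and `h v` are orthogonal.
    have h2 : ∀ σ : ℝ, |σ| = |h| → ‖v‖ * ((ε + |h|) / 2) ≤
        ‖(ε : ℂ) * (Complex.I * v) + σ * v‖ := by
      intro σ hσ
      have : (ε : ℂ) * (Complex.I * v) + σ * v = v * (σ + ε * Complex.I) := by ring
      rw [this, norm_mul, ← hσ]
      refine mul_le_mul_of_nonneg_left ?_ hv'.le
      have hr := Complex.abs_re_le_norm ((σ : ℂ) + ε * Complex.I)
      have hi := Complex.abs_im_le_norm ((σ : ℂ) + ε * Complex.I)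
      simp [abs_of_pos hε] at hr hi
      linarith
    have hm : min (c / 2) (‖v‖ / 4) * (ε + |h|) ≤ ‖v‖ / 4 * (ε + |h|) :=
      mul_le_mul_of_nonneg_right (min_le_right _ _) (by positivity)
    have h3 : 0 ≤ ‖v‖ * ε := by positivity
    constructor
    · have e1 := h2 (-h) (abs_neg h)
      have e2 := norm_sub_le ((ε : ℂ) * (Complex.I * v) - d) (h * v - d)
      rw [norm_sub_rev ((h : ℂ) * v)] at e2
      have e3 : (ε : ℂ) * (Complex.I * v) - d - (h * v - d) =
        ε * (Complex.I * v) + (-h : ℝ) * v := by push_cast; ring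
      rw [e3] at e2
      linarith
    · have e1 := h2 h rfl
      have e2 := norm_sub_le ((ε : ℂ) * (Complex.I * v) + d) (d - h * v)
      have e3 : (ε : ℂ) * (Complex.I * v) + d - (d - h * v) = ε * (Complex.I * v) + h * v := by ring
      rw [e3] at e2
      linarith
  · have h1 : c * |h| ≤ ‖d‖ := by
      have := hc (θ₀ + h) θ₀ (by simpa using hh)
      simpa using this
    have h2 : ε * (‖v‖ + c / 2) ≤ c * η / 2 := ((lt_div_iff₀ (by positivity)).1 hε₀).le
    have h3 : c * η ≤ c * |h| := mul_le_mul_of_nonneg_left (not_lt.1 hsmall) hc0.le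
    have hm : min (c / 2) (‖v‖ / 4) * (ε + |h|) ≤ c / 2 * (ε + |h|) :=
      mul_le_mul_of_nonneg_right (min_le_left _ _) (by positivity)
    constructor
    · have e := norm_sub_norm_le d ((ε : ℂ) * (Complex.I * v))
      rw [norm_sub_rev d ((ε : ℂ) * _), hεv] at e
      linarith
    · have e := norm_sub_norm_le d (-((ε : ℂ) * (Complex.I * v)))
      rw [sub_neg_eq_add, norm_neg, hεv, add_comm d] at e
      linarith

theorem integral_inv_one_add_sq_smul (a : ℂ) :
    ∫ s : ℝ, a * ((1 + s ^ 2)⁻¹ : ℝ) = a * Real.pi := by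
  rw [integral_const_mul, integral_complex_ofReal, integral_univ_inv_one_add_sq]

/-- Jump relation: the Cauchy transform of a continuous density cannot vanish on both sides of a
regular simple closed curve unless the density vanishes. -/
theorem density_eq_zero_of_cauchyTransform {f : ℝ → ℝ} {γ : ℝ → ℂ} (hf : Continuous f)
    (hfper : Function.Periodic f (2 * Real.pi)) (hγ : Continuous γ)
    (hper : Function.Periodic γ (2 * Real.pi)) {c : ℝ} (hc0 : 0 < c)
    (hc : ∀ x y, |x - y| ≤ Real.pi → c * |x - y| ≤ ‖γ x - γ y‖) {θ₀ : ℝ} {v : ℂ} (hv : v ≠ 0)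
    (hd : HasDerivAt γ v θ₀) (hC : ∀ z ∉ range γ, cauchyTransform f γ z = 0) : f θ₀ = 0 := by
  have hpi := Real.pi_pos
  obtain ⟨m, hm, ε₀, hε₀, hsep⟩ := exists_normal_separation hc0 hc hv hd
  obtain ⟨B, hB⟩ : ∃ B, ∀ θ, |f θ| ≤ B := by
    obtain ⟨B, hB⟩ := (hfper.compact_of_continuous (by positivity) hf).isBounded.exists_norm_le
    exact ⟨B, fun θ => hB _ (mem_range_self θ)⟩
  have hB0 : 0 ≤ B := (abs_nonneg _).trans (hB 0)
  set d : ℝ → ℂ := fun h => γ (θ₀ + h) - γ θ₀ with hd_def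
  have hdc : Continuous d := by fun_prop
  set n : ℂ := Complex.I * v with hn
  -- The difference of the Cauchy kernels at the points `γ θ₀ ± ε n`.
  set G : ℝ → ℝ → ℂ := fun ε h => (f (θ₀ + h) : ℂ) * ((ε * n - d h)⁻¹ + (ε * n + d h)⁻¹) with hG
  have hne : ∀ ε, 0 < ε → ε < ε₀ → ∀ h, |h| ≤ Real.pi →
      ε * n - d h ≠ 0 ∧ ε * n + d h ≠ 0 := by
    intro ε hε hε' h hh
    have hpos : 0 < m * (ε + |h|) := by positivity
    exact ⟨norm_pos_iff.1 (hpos.trans_le (hsep ε hε hε' h hh).1),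
      norm_pos_iff.1 (hpos.trans_le (hsep ε hε hε' h hh).2)⟩
  have hshift : ∀ z, cauchyTransform f γ z =
      ∫ h in (-Real.pi)..Real.pi, (f (θ₀ + h) : ℂ) / (z - γ (θ₀ + h)) := by
    intro z
    have hp : Function.Periodic (fun θ => (f θ : ℂ) / (z - γ θ)) (2 * Real.pi) := fun θ => by
      simp only [hfper θ, hper θ]
    have := hp.intervalIntegral_add_eq 0 (θ₀ + -Real.pi)
    rw [zero_add] at this
    rw [cauchyTransform, this, intervalIntegral.integral_comp_add_left
      (fun θ => (f θ : ℂ) / (z - γ θ))]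
    congr 1; ring
  have hnotin : ∀ z, (∀ h, |h| ≤ Real.pi → z - γ (θ₀ + h) ≠ 0) → z ∉ range γ := by
    rintro z hz ⟨θ, rfl⟩
    have hT : 0 < 2 * Real.pi := by positivity
    have h1 := toIcoMod_mem_Ico hT (-Real.pi) (θ - θ₀)
    refine hz (toIcoMod hT (-Real.pi) (θ - θ₀)) (abs_le.2 ⟨h1.1, by linarith [h1.2]⟩) ?_
    have : θ₀ + toIcoMod hT (-Real.pi) (θ - θ₀) =
        θ - toIcoDiv hT (-Real.pi) (θ - θ₀) • (2 * Real.pi) := by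
      rw [toIcoMod]; ring
    rw [this, hper.sub_zsmul_eq, sub_self]
  have hzero : ∀ ε, 0 < ε → ε < ε₀ → ∫ h in (-Real.pi)..Real.pi, G ε h = 0 := by
    intro ε hε hε'
    have e1 : ∀ h, γ θ₀ + ε * n - γ (θ₀ + h) = ε * n - d h := fun h => by simp only [hd_def]; ring
    have e2 : ∀ h, γ θ₀ - ε * n - γ (θ₀ + h) = -(ε * n + d h) := fun h => by
      simp only [hd_def]; ring
    have z1 := hC (γ θ₀ + ε * n) (hnotin _ fun h hh => by rw [e1]; exact (hne ε hε hε' h hh).1)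
    have z2 := hC (γ θ₀ - ε * n) (hnotin _ fun h hh => by
      rw [e2]; exact neg_ne_zero.2 (hne ε hε hε' h hh).2)
    rw [hshift] at z1 z2
    have hmem : ∀ h ∈ uIcc (-Real.pi) Real.pi, |h| ≤ Real.pi := fun h hh => by
      rw [uIcc_of_le (by linarith)] at hh
      exact abs_le.2 hh
    have hfc : Continuous fun h => (f (θ₀ + h) : ℂ) := by fun_prop
    have : ∫ h in (-Real.pi)..Real.pi, G ε h =
        (∫ h in (-Real.pi)..Real.pi, (f (θ₀ + h) : ℂ) / (γ θ₀ + ε * n - γ (θ₀ + h))) -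
        ∫ h in (-Real.pi)..Real.pi, (f (θ₀ + h) : ℂ) / (γ θ₀ - ε * n - γ (θ₀ + h)) := by
      rw [← intervalIntegral.integral_sub]
      · refine intervalIntegral.integral_congr fun h _ => ?_
        simp only [hG, e1, e2, div_neg, sub_neg_eq_add]
        ring
      · refine ContinuousOn.intervalIntegrable (ContinuousOn.div (by fun_prop) (by fun_prop) ?_)
        intro h hh
        rw [e1]; exact (hne ε hε hε' h (hmem h hh)).1
      · refine ContinuousOn.intervalIntegrable (ContinuousOn.div (by fun_prop) (by fun_prop) ?_)
        intro h hh
        rw [e2]; exact neg_ne_zero.2 (hne ε hε hε' h (hmem h hh)).2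
    rw [this, z1, z2, sub_zero]
  -- The same integral in the blown-up parameter `s = h / ε`, as an integral over the line.
  set K : ℝ → ℝ → ℂ := fun ε s =>
    (Ioc (-(Real.pi / ε)) (Real.pi / ε)).indicator (fun s => ε * G ε (ε * s)) s with hK
  have hKint : ∀ ε, 0 < ε → ε < ε₀ → ∫ s, K ε s = 0 := by
    intro ε hε hε'
    have hle : -(Real.pi / ε) ≤ Real.pi / ε := by
      have : 0 < Real.pi / ε := by positivity
      linarith
    rw [hK, integral_indicator measurableSet_Ioc, ← intervalIntegral.integral_of_le hle,
      intervalIntegral.integral_const_mul, intervalIntegral.integral_comp_mul_left (G ε) hε.ne',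
      mul_neg, mul_div_cancel₀ _ hε.ne', hzero ε hε hε', smul_zero, mul_zero]
  have hscale : ∀ ε : ℝ, 0 < ε → ∀ s, ε * G ε (ε * s) = (f (θ₀ + ε * s) : ℂ) *
      ((n - d (ε * s) / ε)⁻¹ + (n + d (ε * s) / ε)⁻¹) := by
    intro ε hε s
    have hε' : (ε : ℂ) ≠ 0 := by exact_mod_cast hε.ne'
    have e1 : (ε * n - d (ε * s)) = ε * (n - d (ε * s) / ε) := by field_simp
    have e2 : (ε * n + d (ε * s)) = ε * (n + d (ε * s) / ε) := by field_simp
    simp only [hG, e1, e2, mul_inv]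
    field_simp
  have hlimit : Tendsto (fun ε => ∫ s, K ε s) (𝓝[>] 0)
      (𝓝 (∫ s : ℝ, (-2 * Complex.I * f θ₀ / v) * ((1 + s ^ 2)⁻¹ : ℝ))) := by
    refine tendsto_integral_filter_of_dominated_convergence
      (fun s => 2 * B * ‖v‖ / m ^ 2 * (1 + s ^ 2)⁻¹) ?_ ?_ ?_ ?_
    · refine Eventually.of_forall fun ε => Measurable.aestronglyMeasurable ?_
      refine Measurable.indicator ?_ measurableSet_Ioc
      have := hf.measurable
      have := hdc.measurable
      fun_prop
    · filter_upwards [Ioo_mem_nhdsGT hε₀] with ε ⟨hε, hε'⟩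
      refine ae_of_all _ fun s => ?_
      by_cases hs : s ∈ Ioc (-(Real.pi / ε)) (Real.pi / ε)
      · rw [hK]
        simp only [indicator_of_mem hs]
        have hεs : |ε * s| ≤ Real.pi := by
          have : |s| ≤ Real.pi / ε := abs_le.2 ⟨hs.1.le, hs.2⟩
          rw [abs_mul, abs_of_pos hε]
          rwa [le_div_iff₀' hε] at this
        obtain ⟨n1, n2⟩ := hne ε hε hε' _ hεs
        obtain ⟨s1, s2⟩ := hsep ε hε hε' _ hεs
        have hadd : (ε * n - d (ε * s))⁻¹ + (ε * n + d (ε * s))⁻¹ =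
            2 * ε * n / ((ε * n - d (ε * s)) * (ε * n + d (ε * s))) := by
          field_simp
          ring
        have hnn : ‖n‖ = ‖v‖ := by rw [hn, norm_mul, Complex.norm_I, one_mul]
        have hden : m ^ 2 * ε ^ 2 * (1 + s ^ 2) ≤
            ‖ε * n - d (ε * s)‖ * ‖ε * n + d (ε * s)‖ := by
          refine le_trans ?_ (mul_le_mul s1 s2 (by positivity) (norm_nonneg _))
          rw [abs_mul, abs_of_pos hε]
          have : 0 ≤ m ^ 2 * ε ^ 2 * (2 * |s|) := by positivity
          nlinarith [sq_abs s]
        have hden0 : 0 < m ^ 2 * ε ^ 2 * (1 + s ^ 2) := by positivity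
        simp only [hG]
        rw [hadd, norm_mul, norm_mul, norm_div, norm_mul (2 * (ε : ℂ)) n, hnn,
          norm_mul (2 : ℂ), norm_mul (_ - _),
          Complex.norm_real, Complex.norm_real, Complex.norm_two, Real.norm_of_nonneg hε.le,
          Real.norm_eq_abs]
        calc ε * (|f (θ₀ + ε * s)| * (2 * ε * ‖v‖ /
              (‖ε * n - d (ε * s)‖ * ‖ε * n + d (ε * s)‖)))
            ≤ ε * (B * (2 * ε * ‖v‖ / (m ^ 2 * ε ^ 2 * (1 + s ^ 2)))) := by
              have := hB (θ₀ + ε * s)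
              gcongr
          _ = 2 * B * ‖v‖ / m ^ 2 * (1 + s ^ 2)⁻¹ := by field_simp
      · rw [hK]
        simp only [indicator_of_notMem hs, norm_zero]
        positivity
    · exact integrable_inv_one_add_sq.const_mul _
    · refine ae_of_all _ fun s => ?_
      have hlim0 : Tendsto (fun ε : ℝ => θ₀ + ε * s) (𝓝[>] 0) (𝓝 θ₀) := by
        have : Continuous fun ε : ℝ => θ₀ + ε * s := by fun_prop
        simpa using (this.tendsto 0).mono_left nhdsWithin_le_nhds
      have hdlim : Tendsto (fun ε : ℝ => d (ε * s) / ε) (𝓝[>] 0) (𝓝 (s * v)) := by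
        have h1 : HasDerivAt (fun ε : ℝ => γ (θ₀ + ε * s)) (s • v) 0 := by
          have h2 : HasDerivAt (fun ε : ℝ => θ₀ + ε * s) s 0 := by
            simpa using ((hasDerivAt_id (0 : ℝ)).mul_const s).const_add θ₀
          have h3 : HasDerivAt γ v (θ₀ + 0 * s) := by simpa using hd
          exact h3.scomp 0 h2
        have h4 := h1.tendsto_slope_zero_right
        simp only [zero_add, zero_mul, add_zero] at h4
        rw [Complex.real_smul] at h4
        refine h4.congr fun ε => ?_
        rw [Complex.real_smul, Complex.ofReal_inv, div_eq_inv_mul]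
      have hsI : ∀ σ : ℝ, Complex.I + σ ≠ 0 := fun σ h => by
        have := congrArg Complex.im h
        simp at this
      have hm1 : n - s * v ≠ 0 := by
        have : n - s * v = v * (Complex.I + (-s : ℝ)) := by rw [hn]; push_cast; ring
        rw [this]; exact mul_ne_zero hv (hsI _)
      have hm2 : n + s * v ≠ 0 := by
        have : n + s * v = v * (Complex.I + s) := by rw [hn]; ring
        rw [this]; exact mul_ne_zero hv (hsI _)
      have hmain : Tendsto (fun ε : ℝ => (f (θ₀ + ε * s) : ℂ) *
          ((n - d (ε * s) / ε)⁻¹ + (n + d (ε * s) / ε)⁻¹)) (𝓝[>] 0)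
          (𝓝 ((f θ₀ : ℂ) * ((n - s * v)⁻¹ + (n + s * v)⁻¹))) := by
        refine Tendsto.mul ?_ (((tendsto_const_nhds.sub hdlim).inv₀ hm1).add
          ((tendsto_const_nhds.add hdlim).inv₀ hm2))
        exact (Complex.continuous_ofReal.tendsto _).comp ((hf.tendsto _).comp hlim0)
      have hval : (f θ₀ : ℂ) * ((n - s * v)⁻¹ + (n + s * v)⁻¹) =
          (-2 * Complex.I * f θ₀ / v) * ((1 + s ^ 2)⁻¹ : ℝ) := by
        have h1 : ((1 + s ^ 2 : ℝ) : ℂ) ≠ 0 := by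
          have : (1 + s ^ 2 : ℝ) ≠ 0 := by positivity
          exact_mod_cast this
        have h2 : (n - s * v)⁻¹ + (n + s * v)⁻¹ = 2 * n / ((n - s * v) * (n + s * v)) := by
          field_simp
          ring
        have h3 : (n - s * v) * (n + s * v) = -(v ^ 2 * ((1 + s ^ 2 : ℝ) : ℂ)) := by
          rw [hn]
          push_cast
          linear_combination v ^ 2 * Complex.I_sq
        rw [h2, h3, Complex.ofReal_inv, hn]
        field_simp
      rw [← hval]
      refine hmain.congr' ?_
      -- For small `ε` the point `s` lies in the rescaled interval.
      have hbig : ∀ᶠ ε : ℝ in 𝓝[>] 0, |ε * s| < Real.pi := by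
        have : Continuous fun ε : ℝ => |ε * s| := by fun_prop
        exact ((this.tendsto 0).mono_left nhdsWithin_le_nhds).eventually_lt_const (by simpa)
      filter_upwards [hbig, self_mem_nhdsWithin] with ε hε hpos
      have hpos' : 0 < ε := hpos
      have hs : s ∈ Ioc (-(Real.pi / ε)) (Real.pi / ε) := by
        have : |s| < Real.pi / ε := by
          rw [lt_div_iff₀' hpos']
          rwa [abs_mul, abs_of_pos hpos'] at hε
        exact ⟨(abs_lt.1 this).1, (abs_lt.1 this).2.le⟩
      rw [hK]
      simp only [indicator_of_mem hs]
      exact (hscale ε hpos' s).symm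
  have hlim0 : Tendsto (fun ε => ∫ s, K ε s) (𝓝[>] 0) (𝓝 0) := by
    refine tendsto_const_nhds.congr' ?_
    filter_upwards [Ioo_mem_nhdsGT hε₀] with ε hε
    exact (hKint ε hε.1 hε.2).symm
  have hfin := tendsto_nhds_unique hlimit hlim0
  rw [integral_inv_one_add_sq_smul] at hfin
  have hpi' : (Real.pi : ℂ) ≠ 0 := by exact_mod_cast hpi.ne'
  simpa [hv, hpi', Complex.I_ne_zero] using hfin

/-! ### Wirtinger derivatives and the transport formula -/

theorem realLinear_apply (L : ℂ →L[ℝ] ℂ) (a : ℂ) : L a = a.re * L 1 + a.im * L Complex.I := by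
  conv_lhs => rw [← Complex.re_add_im a]
  rw [map_add, ← Complex.real_smul, ← Complex.real_smul, ← Complex.real_smul, ← map_smul,
    ← map_smul]
  simp

theorem wirtingerDBar_holomorphic_mul {h g : ℂ → ℂ} {z : ℂ} (hh : DifferentiableAt ℂ h z)
    (hg : DifferentiableAt ℝ g z) :
    wirtingerDBar (fun w => h w * g w) z = h z * wirtingerDBar g z := by
  have h1 := (hh.hasFDerivAt.restrictScalars ℝ).mul hg.hasFDerivAt
  have h2 : fderiv ℂ h z Complex.I = Complex.I * fderiv ℂ h z 1 := by
    rw [← smul_eq_mul, ← map_smul, smul_eq_mul, mul_one]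
  have h3 := h1.fderiv
  simp only [wirtingerDBar]
  change fderiv ℝ (fun w => h w * g w) z = _ at h3
  rw [h3]
  simp only [add_apply, smul_apply, smul_eq_mul, ContinuousLinearMap.coe_restrictScalars', h2]
  linear_combination (g z * fderiv ℂ h z 1 / 2) * Complex.I_sq

section Potential

variable {U : ℂ → ℝ}

theorem wirtingerD_ofReal_comp {z : ℂ} (hU : DifferentiableAt ℝ U z) :
    wirtingerD (fun w => (U w : ℂ)) z =
      ((fderiv ℝ U z 1 : ℝ) - Complex.I * (fderiv ℝ U z Complex.I : ℝ)) / 2 := by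
  have := (Complex.ofRealCLM.hasFDerivAt.comp z hU.hasFDerivAt).fderiv
  change fderiv ℝ (fun w => (U w : ℂ)) z = _ at this
  simp [wirtingerD, this]

theorem wirtingerDBar_ofReal_comp {z : ℂ} (hU : DifferentiableAt ℝ U z) :
    wirtingerDBar (fun w => (U w : ℂ)) z =
      ((fderiv ℝ U z 1 : ℝ) + Complex.I * (fderiv ℝ U z Complex.I : ℝ)) / 2 := by
  have := (Complex.ofRealCLM.hasFDerivAt.comp z hU.hasFDerivAt).fderiv
  change fderiv ℝ (fun w => (U w : ℂ)) z = _ at this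
  simp [wirtingerDBar, this]

theorem contDiffOn_wirtingerD_ofReal {V : Set ℂ} (hV : IsOpen V) (hU : ContDiffOn ℝ ∞ U V) :
    ContDiffOn ℝ ∞ (wirtingerD fun w => (U w : ℂ)) V := by
  have h1 : ContDiffOn ℝ ∞ (fun w => (U w : ℂ)) V := Complex.ofRealCLM.contDiff.comp_contDiffOn hU
  have h2 := h1.fderiv_of_isOpen (m := ∞) hV (by simp)
  unfold wirtingerD
  exact ((h2.clm_apply contDiffOn_const).sub
    (contDiffOn_const.mul (h2.clm_apply contDiffOn_const))).div_const _

/-- The operators `∂` and `∂̄` commute on a real-valued function, and `∂∂̄U` is real. -/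
theorem wirtingerDBar_wirtingerD_eq_backgroundDensity {V : Set ℂ} (hV : IsOpen V)
    (hU : ContDiffOn ℝ ∞ U V) {z : ℂ} (hz : z ∈ V) :
    wirtingerDBar (wirtingerD fun w => (U w : ℂ)) z = backgroundDensity U z := by
  have hUd : ∀ w ∈ V, DifferentiableAt ℝ U w := fun w hw =>
    (hU.contDiffAt (hV.mem_nhds hw)).differentiableAt (by simp)
  have hH : HasFDerivAt (fderiv ℝ U) (fderiv ℝ (fderiv ℝ U) z) z :=
    (((hU.fderiv_of_isOpen (m := ∞) hV (by simp)).contDiffAt (hV.mem_nhds hz)).differentiableAt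
      (by simp)).hasFDerivAt
  have hsymm : IsSymmSndFDerivAt ℝ U z :=
    (hU.contDiffAt (hV.mem_nhds hz)).isSymmSndFDerivAt (by simpa using ENat.LEInfty.out)
  set H := fderiv ℝ (fderiv ℝ U) z with hHdef
  have happ : ∀ e : ℂ, HasFDerivAt (fun w => ((fderiv ℝ U w e : ℝ) : ℂ))
      (Complex.ofRealCLM ∘L H.flip e) z := fun e => by
    have h1 : HasFDerivAt (fun w => fderiv ℝ U w e) (H.flip e) z := by
      have := hH.clm_apply (hasFDerivAt_const e z)
      simpa using this
    exact Complex.ofRealCLM.hasFDerivAt.comp z h1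
  have hD : fderiv ℝ (wirtingerD fun w => (U w : ℂ)) z = (2⁻¹ : ℂ) •
      (Complex.ofRealCLM ∘L H.flip 1 - Complex.I • (Complex.ofRealCLM ∘L H.flip Complex.I)) := by
    have h1 := ((happ 1).sub ((happ Complex.I).const_mul Complex.I)).const_mul (2⁻¹ : ℂ)
    refine (h1.congr_of_eventuallyEq ?_).fderiv
    filter_upwards [hV.mem_nhds hz] with w hw
    rw [wirtingerD_ofReal_comp (hUd w hw), div_eq_inv_mul]
    rfl
  have hDBar : fderiv ℝ (wirtingerDBar fun w => (U w : ℂ)) z = (2⁻¹ : ℂ) •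
      (Complex.ofRealCLM ∘L H.flip 1 + Complex.I • (Complex.ofRealCLM ∘L H.flip Complex.I)) := by
    have h1 := ((happ 1).add ((happ Complex.I).const_mul Complex.I)).const_mul (2⁻¹ : ℂ)
    refine (h1.congr_of_eventuallyEq ?_).fderiv
    filter_upwards [hV.mem_nhds hz] with w hw
    rw [wirtingerDBar_ofReal_comp (hUd w hw), div_eq_inv_mul]
    rfl
  have hs : H 1 Complex.I = H Complex.I 1 := hsymm 1 Complex.I
  have e1 : wirtingerDBar (wirtingerD fun w => (U w : ℂ)) z =
      (((H 1 1 + H Complex.I Complex.I) / 4 : ℝ) : ℂ) := by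
    rw [wirtingerDBar, hD]
    simp [hs]
    linear_combination (-(H Complex.I Complex.I : ℂ) / 4) * Complex.I_sq
  have e2 : wirtingerD (wirtingerDBar fun w => (U w : ℂ)) z =
      (((H 1 1 + H Complex.I Complex.I) / 4 : ℝ) : ℂ) := by
    rw [wirtingerD, hDBar]
    simp [hs]
    linear_combination (-(H Complex.I Complex.I : ℂ) / 4) * Complex.I_sq
  rw [backgroundDensity, e1, e2, Complex.ofReal_re]

end Potential

section Deformation

variable {ζ : ℝ → ℝ → ℂ} {J : Set ℝ}

theorem hasDerivAt_deformation_time (hJ : IsOpen J)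
    (hζ : ContDiffOn ℝ ∞ (Function.uncurry ζ) (J ×ˢ univ)) {t : ℝ} (ht : t ∈ J) (θ : ℝ) :
    HasDerivAt (fun s => ζ s θ) (fderiv ℝ (Function.uncurry ζ) (t, θ) (1, 0)) t := by
  have h1 : HasFDerivAt (Function.uncurry ζ) (fderiv ℝ (Function.uncurry ζ) (t, θ)) (t, θ) :=
    ((hζ.contDiffAt ((hJ.prod isOpen_univ).mem_nhds ⟨ht, mem_univ θ⟩)).differentiableAt
      (by simp)).hasFDerivAt
  exact h1.comp_hasDerivAt t ((hasDerivAt_id t).prodMk (hasDerivAt_const t θ))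

theorem hasDerivAt_deformation_param (hJ : IsOpen J)
    (hζ : ContDiffOn ℝ ∞ (Function.uncurry ζ) (J ×ˢ univ)) {t : ℝ} (ht : t ∈ J) (θ : ℝ) :
    HasDerivAt (ζ t) (fderiv ℝ (Function.uncurry ζ) (t, θ) (0, 1)) θ := by
  have h1 : HasFDerivAt (Function.uncurry ζ) (fderiv ℝ (Function.uncurry ζ) (t, θ)) (t, θ) :=
    ((hζ.contDiffAt ((hJ.prod isOpen_univ).mem_nhds ⟨ht, mem_univ θ⟩)).differentiableAt
      (by simp)).hasFDerivAt
  exact h1.comp_hasDerivAt θ ((hasDerivAt_const θ t).prodMk (hasDerivAt_id θ))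

theorem periodic_deriv_time (hJ : IsOpen J)
    (hper : ∀ s ∈ J, Function.Periodic (ζ s) (2 * Real.pi)) {t : ℝ} (ht : t ∈ J) :
    Function.Periodic (fun θ => deriv (fun s => ζ s θ) t) (2 * Real.pi) := fun θ => by
  refine Filter.EventuallyEq.deriv_eq ?_
  filter_upwards [hJ.mem_nhds ht] with s hs
  exact hper s hs θ

theorem continuous_deriv_time (hJ : IsOpen J)
    (hζ : ContDiffOn ℝ ∞ (Function.uncurry ζ) (J ×ˢ univ)) {t : ℝ} (ht : t ∈ J) :
    Continuous fun θ => deriv (fun s => ζ s θ) t := by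
  have h1 := (hζ.fderiv_of_isOpen (m := ∞) (hJ.prod isOpen_univ) (by simp)).continuousOn
  have h2 : Continuous fun θ : ℝ => fderiv ℝ (Function.uncurry ζ) (t, θ) :=
    h1.comp_continuous (by fun_prop) fun θ => ⟨ht, mem_univ θ⟩
  have h3 : (fun θ => deriv (fun s => ζ s θ) t) =
      fun θ => fderiv ℝ (Function.uncurry ζ) (t, θ) (1, 0) :=
    funext fun θ => (hasDerivAt_deformation_time hJ hζ ht θ).deriv
  rw [h3]
  exact h2.clm_apply continuous_const

/-- Transport formula: the derivative of a contour integral along a moving closed curve is twice `i`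
times the integral of the conjugate derivative of the integrand against the area swept by the curve
per unit of time. -/
theorem hasDerivAt_contourIntegral (hJ : IsOpen J)
    (hζ : ContDiffOn ℝ ∞ (Function.uncurry ζ) (J ×ˢ univ))
    (hper : ∀ s ∈ J, Function.Periodic (ζ s) (2 * Real.pi)) {V : Set ℂ} (hV : IsOpen V)
    (hζV : ∀ s ∈ J, ∀ θ, ζ s θ ∈ V) {g : ℂ → ℂ} (hg : ContDiffOn ℝ ∞ g V) {t : ℝ} (ht : t ∈ J) :
    HasDerivAt (fun s => contourIntegral (ζ s) g)
      (∫ θ in (0 : ℝ)..(2 * Real.pi), 2 * Complex.I * wirtingerDBar g (ζ t θ) *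
        ((starRingEnd ℂ (deriv (fun s => ζ s θ) t) * deriv (ζ t) θ).im : ℝ)) t := by
  set Z := Function.uncurry ζ with hZ
  have hO : IsOpen (J ×ˢ (univ : Set ℝ)) := hJ.prod isOpen_univ
  have hmaps : MapsTo Z (J ×ˢ univ) V := fun p hp => hζV p.1 hp.1 p.2
  have hgZ : ContDiffOn ℝ ∞ (g ∘ Z) (J ×ˢ univ) := hg.comp hζ hmaps
  have hdZ : ContDiffOn ℝ ∞ (fderiv ℝ Z) (J ×ˢ univ) := hζ.fderiv_of_isOpen hO (by simp)
  have hΦ : ∀ e : ℝ × ℝ, ContDiffOn ℝ ∞ (fun p => g (Z p) * fderiv ℝ Z p e) (J ×ˢ univ) :=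
    fun e => hgZ.mul (hdZ.clm_apply contDiffOn_const)
  have hΦd : ∀ e, ∀ p ∈ J ×ˢ (univ : Set ℝ), HasFDerivAt (fun p => g (Z p) * fderiv ℝ Z p e)
      (fderiv ℝ (fun p => g (Z p) * fderiv ℝ Z p e) p) p := fun e p hp =>
    (((hΦ e).contDiffAt (hO.mem_nhds hp)).differentiableAt (by simp)).hasFDerivAt
  have hΦ' : ∀ e, ContinuousOn (fderiv ℝ (fun p => g (Z p) * fderiv ℝ Z p e)) (J ×ˢ univ) :=
    fun e => ((hΦ e).fderiv_of_isOpen (m := ∞) hO (by simp)).continuousOn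
  -- The time derivative of the integrand.
  have h1 : HasDerivAt
      (fun s => ∫ θ in (0 : ℝ)..(2 * Real.pi), g (ζ s θ) * fderiv ℝ Z (s, θ) (0, 1))
      (∫ θ in (0 : ℝ)..(2 * Real.pi),
        fderiv ℝ (fun p => g (Z p) * fderiv ℝ Z p (0, 1)) (t, θ) (1, 0)) t := by
    refine hasDerivAt_intervalIntegral_of_continuousOn (E := ℂ)
      (F := fun s θ => g (ζ s θ) * fderiv ℝ Z (s, θ) (0, 1))
      (F' := fun s θ => fderiv ℝ (fun p => g (Z p) * fderiv ℝ Z p (0, 1)) (s, θ) (1, 0))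
      hJ ht ?_ ?_ ?_
    · intro s hs
      exact (hΦ (0, 1)).continuousOn.comp_continuous (by fun_prop : Continuous fun θ : ℝ => (s, θ))
        fun θ => ⟨hs, mem_univ θ⟩
    · intro s hs θ
      exact (hΦd (0, 1) (s, θ) ⟨hs, mem_univ θ⟩).comp_hasDerivAt s
        ((hasDerivAt_id s).prodMk (hasDerivAt_const s θ))
    · exact (hΦ' (0, 1)).clm_apply continuousOn_const
  have h2 : HasDerivAt (fun s => contourIntegral (ζ s) g)
      (∫ θ in (0 : ℝ)..(2 * Real.pi),
        fderiv ℝ (fun p => g (Z p) * fderiv ℝ Z p (0, 1)) (t, θ) (1, 0)) t := by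
    refine h1.congr_of_eventuallyEq ?_
    filter_upwards [hJ.mem_nhds ht] with s hs
    refine intervalIntegral.integral_congr fun θ _ => ?_
    simp only [(hasDerivAt_deformation_param hJ hζ hs θ).deriv, hZ]
  -- It differs from the integrand of the claim by a derivative in the parameter of the curve.
  have hcont : ∀ e e' : ℝ × ℝ,
      Continuous fun θ : ℝ => fderiv ℝ (fun p => g (Z p) * fderiv ℝ Z p e) (t, θ) e' :=
    fun e e' => ((hΦ' e).comp_continuous (by fun_prop : Continuous fun θ : ℝ => (t, θ))
      fun θ => ⟨ht, mem_univ θ⟩).clm_apply continuous_const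
  have h3 : ∫ θ in (0 : ℝ)..(2 * Real.pi),
      fderiv ℝ (fun p => g (Z p) * fderiv ℝ Z p (1, 0)) (t, θ) (0, 1) = 0 := by
    rw [intervalIntegral.integral_eq_sub_of_hasDerivAt
      (f := fun θ => g (ζ t θ) * fderiv ℝ Z (t, θ) (1, 0))
      (fun θ _ => (hΦd (1, 0) (t, θ) ⟨ht, mem_univ θ⟩).comp_hasDerivAt θ
        ((hasDerivAt_const θ t).prodMk (hasDerivAt_id θ)))
      ((hcont (1, 0) (0, 1)).intervalIntegrable _ _)]
    have e1 := periodic_deriv_time hJ hper ht 0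
    have e2 := hper t ht 0
    simp only [(hasDerivAt_deformation_time hJ hζ ht _).deriv, zero_add] at e1 e2
    rw [e2, e1, sub_self]
  have hlin : ∀ (L : ℂ →L[ℝ] ℂ) (a b : ℂ), L a * b - L b * a =
      2 * Complex.I * ((L 1 + Complex.I * L Complex.I) / 2) * ((starRingEnd ℂ a * b).im : ℝ) := by
    intro L a b
    rw [realLinear_apply L a, realLinear_apply L b]
    have hab : (starRingEnd ℂ a * b).im = a.re * b.im - a.im * b.re := by
      simp [Complex.mul_im]
      ring
    rw [hab]
    conv_lhs => rw [← Complex.re_add_im b, ← Complex.re_add_im a]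
    simp only [Complex.add_re, Complex.add_im, Complex.ofReal_re, Complex.ofReal_im,
      Complex.mul_re, Complex.mul_im, Complex.I_re, Complex.I_im]
    push_cast
    linear_combination (a.im * b.re - a.re * b.im) * L Complex.I * Complex.I_sq
  have h4 : ∀ θ, fderiv ℝ (fun p => g (Z p) * fderiv ℝ Z p (0, 1)) (t, θ) (1, 0) =
      2 * Complex.I * wirtingerDBar g (ζ t θ) *
        ((starRingEnd ℂ (deriv (fun s => ζ s θ) t) * deriv (ζ t) θ).im : ℝ) +
      fderiv ℝ (fun p => g (Z p) * fderiv ℝ Z p (1, 0)) (t, θ) (0, 1) := by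
    intro θ
    have hp : (t, θ) ∈ J ×ˢ (univ : Set ℝ) := ⟨ht, mem_univ θ⟩
    have hZd : HasFDerivAt Z (fderiv ℝ Z (t, θ)) (t, θ) :=
      ((hζ.contDiffAt (hO.mem_nhds hp)).differentiableAt (by simp)).hasFDerivAt
    have hgd : HasFDerivAt g (fderiv ℝ g (ζ t θ)) (Z (t, θ)) :=
      ((hg.contDiffAt (hV.mem_nhds (hmaps hp))).differentiableAt (by simp)).hasFDerivAt
    have hZdd : HasFDerivAt (fderiv ℝ Z) (fderiv ℝ (fderiv ℝ Z) (t, θ)) (t, θ) :=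
      ((hdZ.contDiffAt (hO.mem_nhds hp)).differentiableAt (by simp)).hasFDerivAt
    have hsymm : IsSymmSndFDerivAt ℝ Z (t, θ) :=
      (hζ.contDiffAt (hO.mem_nhds hp)).isSymmSndFDerivAt (by simpa using ENat.LEInfty.out)
    have hform : ∀ e e' : ℝ × ℝ, fderiv ℝ (fun p => g (Z p) * fderiv ℝ Z p e) (t, θ) e' =
        g (ζ t θ) * fderiv ℝ (fderiv ℝ Z) (t, θ) e' e +
        fderiv ℝ Z (t, θ) e * fderiv ℝ g (ζ t θ) (fderiv ℝ Z (t, θ) e') := by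
      intro e e'
      have hE : HasFDerivAt (fun p => fderiv ℝ Z p e) ((fderiv ℝ (fderiv ℝ Z) (t, θ)).flip e)
          (t, θ) := by
        simpa using hZdd.clm_apply (hasFDerivAt_const e (t, θ))
      have hP := ((hgd.comp (t, θ) hZd).mul hE).fderiv
      change fderiv ℝ (fun p => g (Z p) * fderiv ℝ Z p e) (t, θ) = _ at hP
      rw [hP]
      simp [hZ]
    rw [hform, hform, hsymm (0, 1) (1, 0), (hasDerivAt_deformation_time hJ hζ ht θ).deriv,
      (hasDerivAt_deformation_param hJ hζ ht θ).deriv, wirtingerDBar, ← hlin]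
    ring
  have h5 : Continuous fun θ => 2 * Complex.I * wirtingerDBar g (ζ t θ) *
      ((starRingEnd ℂ (deriv (fun s => ζ s θ) t) * deriv (ζ t) θ).im : ℝ) := by
    have : (fun θ => 2 * Complex.I * wirtingerDBar g (ζ t θ) *
      ((starRingEnd ℂ (deriv (fun s => ζ s θ) t) * deriv (ζ t) θ).im : ℝ)) = fun θ =>
        fderiv ℝ (fun p => g (Z p) * fderiv ℝ Z p (0, 1)) (t, θ) (1, 0) -
        fderiv ℝ (fun p => g (Z p) * fderiv ℝ Z p (1, 0)) (t, θ) (0, 1) :=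
      funext fun θ => by rw [h4, add_sub_cancel_right]
    rw [this]
    exact (hcont _ _).sub (hcont _ _)
  rw [intervalIntegral.integral_congr (fun θ _ => h4 θ), intervalIntegral.integral_add
    (h5.intervalIntegrable _ _) ((hcont _ _).intervalIntegrable _ _), h3, add_zero] at h2
  exact h2

end Deformation

/-! ### Rigidity of a boundary with zero normal velocity -/

/-- If a continuous function on an interval exceeds, near each point, its value there by at most an
arbitrarily small multiple of the distance, then it is constant; by symmetry in `s` and `t` the
inequality suffices. -/
theorem le_of_forall_eventually_le_add {J : Set ℝ} (hJ : J.OrdConnected) {d : ℝ → ℝ}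
    (hd : ContinuousOn d J)
    (hrate : ∀ x ∈ J, ∀ r > 0, ∀ᶠ z in 𝓝 x, d z ≤ d x + r * |z - x|) {s t : ℝ} (hs : s ∈ J)
    (ht : t ∈ J) : d t ≤ d s := by
  have key : ∀ (e : ℝ → ℝ) (a b : ℝ), a ≤ b → ContinuousOn e (Icc a b) →
      (∀ x ∈ Icc a b, ∀ r > 0, ∀ᶠ z in 𝓝 x, e z ≤ e x + r * |z - x|) → e b ≤ e a := by
    intro e a b hab he hr
    refine image_le_of_liminf_slope_right_le_deriv_boundary he le_rfl continuousOn_const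
      (B := fun _ => e a) (B' := fun _ => 0) (fun x _ => hasDerivWithinAt_const _ _ _) ?_
      (right_mem_Icc.2 hab)
    intro x hx r hr0
    refine Eventually.frequently ?_
    filter_upwards [(hr x (Ico_subset_Icc_self hx) (r / 2) (half_pos hr0)).filter_mono
      nhdsWithin_le_nhds, self_mem_nhdsWithin] with z hz hxz
    have hpos : 0 < z - x := sub_pos.2 hxz
    rw [abs_of_pos hpos] at hz
    rw [slope_def_field, div_lt_iff₀ hpos]
    have : 0 < r * (z - x) := mul_pos hr0 hpos
    linarith
  rcases le_total s t with h | h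
  · exact key d s t h (hd.mono (hJ.out hs ht)) fun x hx => hrate x (hJ.out hs ht hx)
  · have hmaps : MapsTo (fun x : ℝ => -x) (Icc (-s) (-t)) J := fun x hx =>
      hJ.out ht hs ⟨by linarith [hx.2], by linarith [hx.1]⟩
    have := key (fun x => d (-x)) (-s) (-t) (by linarith)
      (hd.comp continuousOn_id.neg hmaps) fun x hx r hr => by
        have h1 := (continuous_neg.tendsto x).eventually (hrate (-x) (hmaps hx) r hr)
        filter_upwards [h1] with z hz
        rwa [show -z - -x = -(z - x) by ring, abs_neg] at hz
    simpa using this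

theorem inner_eq_zero_of_im_conj_mul_eq_zero {a b q : ℂ} (hb : b ≠ 0)
    (hab : (starRingEnd ℂ a * b).im = 0) (hqb : inner ℝ q b = 0) : inner ℝ q a = 0 := by
  rw [Complex.inner] at hqb ⊢
  simp only [Complex.mul_im, Complex.mul_re, Complex.conj_re, Complex.conj_im] at *
  by_contra hne
  refine hb (Complex.ext ?_ ?_)
  · refine (mul_eq_zero.1 ?_).resolve_right hne
    linear_combination a.re * hqb - q.im * hab
  · refine (mul_eq_zero.1 ?_).resolve_right hne
    linear_combination a.im * hqb + q.re * hab

theorem normalVelocity_eq (ζ : ℝ → ℝ → ℂ) (t θ : ℝ) :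
    normalVelocity ζ t θ =
      (starRingEnd ℂ (deriv (fun s => ζ s θ) t) * deriv (ζ t) θ).im / ‖deriv (ζ t) θ‖ := by
  rw [normalVelocity, outwardNormal, Complex.inner, div_mul_eq_mul_div, Complex.div_ofReal_re]
  congr 1
  simp [Complex.mul_re, Complex.mul_im]
  ring

/-- A closed curve moving with zero normal velocity does not move as a set: by the envelope
argument, the square of its distance to any fixed point has zero derivative. -/
theorem range_subset_range_of_normalVelocity_eq_zero {ζ : ℝ → ℝ → ℂ} {J : Set ℝ} (hJo : IsOpen J)
    (hJc : J.OrdConnected) (hζ : ContDiffOn ℝ ∞ (Function.uncurry ζ) (J ×ˢ univ))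
    (hper : ∀ s ∈ J, Function.Periodic (ζ s) (2 * Real.pi))
    (hreg : ∀ s ∈ J, ∀ θ, deriv (ζ s) θ ≠ 0)
    (hV : ∀ s ∈ J, ∀ θ, normalVelocity ζ s θ = 0) {s t : ℝ} (hs : s ∈ J) (ht : t ∈ J) :
    range (ζ s) ⊆ range (ζ t) := by
  have hT : 0 < 2 * Real.pi := by positivity
  rintro p ⟨φ, rfl⟩
  set p := ζ s φ with hp
  set d : ℝ → ℝ := fun x => sInf ((fun θ => ‖ζ x θ - p‖ ^ 2) '' Icc 0 (2 * Real.pi)) with hd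
  have hcont : ∀ x ∈ J, Continuous fun θ => ‖ζ x θ - p‖ ^ 2 := fun x hx => by
    have : Continuous (ζ x) := hζ.continuousOn.comp_continuous
      (by fun_prop : Continuous fun θ : ℝ => (x, θ)) fun θ => ⟨hx, mem_univ θ⟩
    fun_prop
  have hmin : ∀ x ∈ J, ∃ θ, d x = ‖ζ x θ - p‖ ^ 2 ∧ ∀ θ', d x ≤ ‖ζ x θ' - p‖ ^ 2 := by
    intro x hx
    obtain ⟨θ, hθ, h1, h2⟩ := isCompact_Icc.exists_sInf_image_eq_and_le (nonempty_Icc.2 hT.le)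
      (hcont x hx).continuousOn
    refine ⟨θ, h1, fun θ' => ?_⟩
    have h3 := h2 (toIcoMod hT 0 θ')
      (Ico_subset_Icc_self (by simpa using toIcoMod_mem_Ico hT 0 θ'))
    rw [toIcoMod, (hper x hx).sub_zsmul_eq, ← h1] at h3
    exact h3
  have hdc : ContinuousOn d J := by
    rw [continuousOn_iff_continuous_domRestrict]
    refine isCompact_Icc.continuous_sInf (f := fun (x : J) θ => ‖ζ x θ - p‖ ^ 2) ?_
    have : Continuous fun q : J × ℝ => Function.uncurry ζ ((q.1 : ℝ), q.2) :=
      hζ.continuousOn.comp_continuous (by fun_prop) fun q => ⟨q.1.2, mem_univ _⟩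
    exact ((this.sub continuous_const).norm.pow 2)
  have hrate : ∀ x ∈ J, ∀ r > 0, ∀ᶠ z in 𝓝 x, d z ≤ d x + r * |z - x| := by
    intro x hx r hr
    obtain ⟨θ, hθ, hle⟩ := hmin x hx
    have hparam : HasDerivAt (fun θ => ‖ζ x θ - p‖ ^ 2)
        (2 * inner ℝ (ζ x θ - p) (deriv (ζ x) θ)) θ :=
      ((hasDerivAt_deformation_param hJo hζ hx θ).differentiableAt.hasDerivAt.sub_const p).norm_sq
    have hcrit : inner ℝ (ζ x θ - p) (deriv (ζ x) θ) = 0 := by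
      have hloc : IsLocalMin (fun θ => ‖ζ x θ - p‖ ^ 2) θ :=
        Eventually.of_forall fun θ' => by simpa only [← hθ] using hle θ'
      have := hloc.hasDerivAt_eq_zero hparam
      linarith
    have hVx := hV x hx θ
    rw [normalVelocity_eq, div_eq_zero_iff, or_iff_left (norm_ne_zero_iff.2 (hreg x hx θ))] at hVx
    have htime : HasDerivAt (fun y => ‖ζ y θ - p‖ ^ 2)
        (2 * inner ℝ (ζ x θ - p) (deriv (fun y => ζ y θ) x)) x :=
      ((hasDerivAt_deformation_time hJo hζ hx θ).differentiableAt.hasDerivAt.sub_const p).norm_sq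
    rw [inner_eq_zero_of_im_conj_mul_eq_zero (hreg x hx θ) hVx hcrit, mul_zero] at htime
    have hlo := htime.isLittleO.def hr
    filter_upwards [hlo, hJo.mem_nhds hx] with z hz hzJ
    obtain ⟨-, -, hzle⟩ := hmin z hzJ
    have h1 := hzle θ
    simp only [smul_zero, sub_zero, Real.norm_eq_abs] at hz
    have h2 := (le_abs_self _).trans hz
    rw [← hθ] at h2
    linarith
  have hle := le_of_forall_eventually_le_add hJc hdc hrate hs ht
  obtain ⟨-, -, h1⟩ := hmin s hs
  obtain ⟨θ, h2, -⟩ := hmin t ht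
  have h3 := h1 φ
  rw [← hp, sub_self, norm_zero] at h3
  have h4 : ‖ζ t θ - p‖ ^ 2 ≤ 0 := by
    rw [← h2]; exact hle.trans (by simpa using h3)
  refine ⟨θ, ?_⟩
  have h5 : ‖ζ t θ - p‖ = 0 := by
    have := sq_nonneg ‖ζ t θ - p‖
    exact pow_eq_zero_iff two_ne_zero |>.1 (le_antisymm h4 this)
  exact sub_eq_zero.1 (norm_eq_zero.1 h5)

theorem interior_subset_interior_of_frontier_eq {X : Type*} [TopologicalSpace X] {D E : Set X}
    (hfr : frontier D = frontier E) (hD : IsPreconnected (interior D)) {x : X}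
    (hxD : x ∈ interior D) (hxE : x ∈ interior E) : interior D ⊆ interior E := by
  refine IsPreconnected.subset_left_of_subset_union isOpen_interior
    (isClosed_closure (s := E)).isOpen_compl ?_ ?_ ⟨x, hxD, hxE⟩ hD
  · exact disjoint_compl_right.mono_left interior_subset_closure
  · intro y hy
    by_cases h : y ∈ interior E
    · exact Or.inl h
    · refine Or.inr fun hc => ?_
      have : y ∈ frontier D := hfr ▸ ⟨hc, h⟩
      exact this.2 hy

/-! ### Stationary harmonic moments -/

theorem exists_harmonicMoment_eq_mul (U : ℂ → ℝ) (k : ℕ) : ∃ a : ℂ, a ≠ 0 ∧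
    ∀ γ, harmonicMoment U γ k =
      a * contourIntegral γ (fun z => (z ^ k)⁻¹ * wirtingerD (fun w => (U w : ℂ)) z) := by
  have hpi : (Real.pi : ℂ) ≠ 0 := by exact_mod_cast Real.pi_ne_zero
  cases k with
  | zero =>
    refine ⟨(2 * Real.pi * Complex.I)⁻¹, ?_, fun γ => ?_⟩
    · simp [hpi]
    · simp [harmonicMoment]
  | succ k =>
    refine ⟨(2 * Real.pi * Complex.I * ((k + 1 : ℕ) : ℂ))⁻¹, ?_, fun γ => rfl⟩
    have : ((k + 1 : ℕ) : ℂ) ≠ 0 := by exact_mod_cast Nat.succ_ne_zero k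
    exact inv_ne_zero (mul_ne_zero (mul_ne_zero (mul_ne_zero two_ne_zero hpi) Complex.I_ne_zero)
      this)

/-- Stationary moments force zero normal velocity: the transport formula turns stationarity into the
vanishing of all moments of nonpositive degree of the normal velocity, weighted by the background
density and by the arc length element. -/
theorem normalVelocity_eq_zero_of_moments {U : ℂ → ℝ} (hU : ContDiffOn ℝ ∞ U {z : ℂ | z ≠ 0})
    (hσ : ∀ z : ℂ, z ≠ 0 → 0 < backgroundDensity U z) {J : Set ℝ} (hJ : IsOpen J)
    {D : ℝ → Set ℂ} {ζ : ℝ → ℝ → ℂ} (hD : IsSmoothDeformation J D ζ) {t : ℝ} (ht : t ∈ J)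
    (hmom : ∀ k : ℕ, HasDerivAt (fun s => harmonicMoment U (ζ s) k) 0 t) (θ : ℝ) :
    normalVelocity ζ t θ = 0 := by
  have hV : IsOpen {z : ℂ | z ≠ 0} := isOpen_ne
  have hB := hD.boundary t ht
  have hper : ∀ s ∈ J, Function.Periodic (ζ s) (2 * Real.pi) := fun s hs =>
    (hD.boundary s hs).periodic
  have hζ0 : ∀ s ∈ J, ∀ θ, ζ s θ ∈ {z : ℂ | z ≠ 0} := fun s hs θ h0 => by
    have h1 : ζ s θ ∈ frontier (D s) := (hD.boundary s hs).range_eq ▸ mem_range_self θ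
    rw [h0] at h1
    exact h1.2 (hD.zero_mem s hs)
  set P := wirtingerD fun w => (U w : ℂ) with hP
  have hPs : ContDiffOn ℝ ∞ P {z : ℂ | z ≠ 0} := contDiffOn_wirtingerD_ofReal hV hU
  have hPd : ∀ z : ℂ, z ≠ 0 → DifferentiableAt ℝ P z := fun z hz =>
    (hPs.contDiffAt (hV.mem_nhds hz)).differentiableAt (by simp)
  have hPbar : ∀ z : ℂ, z ≠ 0 → wirtingerDBar P z = backgroundDensity U z := fun z hz =>
    wirtingerDBar_wirtingerD_eq_backgroundDensity hV hU hz
  have hγ : Continuous (ζ t) := hB.smooth.continuous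
  have hdγ : Continuous (deriv (ζ t)) := hB.smooth.continuous_deriv (by simp)
  have hdt := continuous_deriv_time hJ hD.smooth ht
  set f : ℝ → ℝ := fun θ => backgroundDensity U (ζ t θ) *
    (starRingEnd ℂ (deriv (fun s => ζ s θ) t) * deriv (ζ t) θ).im with hf
  have hσc : Continuous fun θ => backgroundDensity U (ζ t θ) := by
    have h1 : ContinuousOn (wirtingerDBar P) {z : ℂ | z ≠ 0} := by
      have h2 := (hPs.fderiv_of_isOpen (m := ∞) hV (by simp)).continuousOn
      unfold wirtingerDBar
      exact ((h2.clm_apply continuousOn_const).add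
        (continuousOn_const.mul (h2.clm_apply continuousOn_const))).div_const _
    have h3 : (fun θ => backgroundDensity U (ζ t θ)) = fun θ => (wirtingerDBar P (ζ t θ)).re :=
      funext fun θ => by rw [hPbar _ (hζ0 t ht θ), Complex.ofReal_re]
    rw [h3]
    exact Complex.continuous_re.comp (h1.comp_continuous hγ (hζ0 t ht))
  have hfc : Continuous f :=
    hσc.mul (Complex.continuous_im.comp ((Complex.continuous_conj.comp hdt).mul hdγ))
  have hfper : Function.Periodic f (2 * Real.pi) := fun θ => by
    have h1 : deriv (ζ t) (θ + 2 * Real.pi) = deriv (ζ t) θ := by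
      rw [← deriv_comp_add_const, hB.periodic.funext]
    have h2 := periodic_deriv_time hJ hper ht θ
    simp only at h2
    simp only [hf, h1, h2, hB.periodic θ]
  have hfmom : ∀ k : ℕ, ∫ θ in (0 : ℝ)..(2 * Real.pi), (f θ : ℂ) * (ζ t θ ^ k)⁻¹ = 0 := by
    intro k
    have hk : ∀ z : ℂ, z ≠ 0 → DifferentiableAt ℂ (fun z : ℂ => (z ^ k)⁻¹) z := fun z hz =>
      (differentiableAt_id.pow k).inv (pow_ne_zero k hz)
    have hg : ContDiffOn ℝ ∞ (fun z => (z ^ k)⁻¹ * P z) {z : ℂ | z ≠ 0} := by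
      refine ContDiffOn.mul (ContDiffOn.inv (by fun_prop) fun z hz => pow_ne_zero k hz) hPs
    have h1 := hasDerivAt_contourIntegral hJ hD.smooth hper hV hζ0 hg ht
    obtain ⟨a, ha, hae⟩ := exists_harmonicMoment_eq_mul U k
    have h2 := hmom k
    simp only [hae] at h2
    have h3 := (h1.const_mul a).unique h2
    have h4 := (mul_eq_zero.1 h3).resolve_left ha
    have h5 : ∀ θ, 2 * Complex.I * wirtingerDBar (fun z => (z ^ k)⁻¹ * P z) (ζ t θ) *
        ((starRingEnd ℂ (deriv (fun s => ζ s θ) t) * deriv (ζ t) θ).im : ℝ) =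
        2 * Complex.I * ((f θ : ℂ) * (ζ t θ ^ k)⁻¹) := fun θ => by
      rw [wirtingerDBar_holomorphic_mul (hk _ (hζ0 t ht θ)) (hPd _ (hζ0 t ht θ)),
        hPbar _ (hζ0 t ht θ), hf]
      push_cast
      ring
    simp only [h5] at h4
    rw [intervalIntegral.integral_const_mul] at h4
    exact (mul_eq_zero.1 h4).resolve_left (mul_ne_zero two_ne_zero Complex.I_ne_zero)
  obtain ⟨c, hc0, hc⟩ := exists_chord_arc_const (hB.smooth.of_le (by simp)) hB.periodic hB.injOn
    hB.deriv_ne_zero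
  have hdom := hD.domain t ht
  have hzero := density_eq_zero_of_cauchyTransform hfc hfper hγ hB.periodic hc0 hc
    (hB.deriv_ne_zero θ) (hB.smooth.differentiable (by simp) θ).hasDerivAt
    fun z hz => cauchyTransform_eq_zero_of_moments hfc hfper hγ hB.periodic hc0 hc
      hdom.closure_interior hdom.simplyConnected.isPathConnected.isConnected.isPreconnected
      (hD.zero_mem t ht) hB.range_eq hfmom hz
  rw [normalVelocity_eq, (mul_eq_zero.1 hzero).resolve_left (hσ _ (hζ0 t ht θ)).ne', zero_div]

theorem mainTheorem11
    (U : ℂ → ℝ)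
    (hU : AnalyticOnNhd ℝ U {z : ℂ | z ≠ 0})
    (hσ : ∀ z : ℂ, z ≠ 0 → 0 < backgroundDensity U z)
    (J : Set ℝ) (hJo : IsOpen J) (hJc : J.OrdConnected) (h0 : (0 : ℝ) ∈ J)
    (D : ℝ → Set ℂ) (ζ : ℝ → ℝ → ℂ) (hD : IsSmoothDeformation J D ζ) :
    (∀ t ∈ J,
      (∀ k : ℕ, HasDerivAt (fun s => harmonicMoment U (ζ s) k) 0 t) →
        ∀ θ : ℝ, normalVelocity ζ t θ = 0) ∧
    ((∀ k : ℕ, ∀ t ∈ J, harmonicMoment U (ζ t) k = harmonicMoment U (ζ 0) k) →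
      ∀ t ∈ J, (∀ θ : ℝ, normalVelocity ζ t θ = 0) ∧ D t = D 0) := by
  have hUs : ContDiffOn ℝ ∞ U {z : ℂ | z ≠ 0} := hU.contDiffOn isOpen_ne.uniqueDiffOn
  have part1 : ∀ t ∈ J, (∀ k : ℕ, HasDerivAt (fun s => harmonicMoment U (ζ s) k) 0 t) →
      ∀ θ : ℝ, normalVelocity ζ t θ = 0 := fun t ht hmom =>
    normalVelocity_eq_zero_of_moments hUs hσ hJo hD ht hmom
  refine ⟨part1, fun hmom => ?_⟩
  have hV : ∀ t ∈ J, ∀ θ, normalVelocity ζ t θ = 0 := fun t ht => part1 t ht fun k => by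
    refine (hasDerivAt_const t (harmonicMoment U (ζ 0) k)).congr_of_eventuallyEq ?_
    filter_upwards [hJo.mem_nhds ht] with s hs
    exact hmom k s hs
  refine fun t ht => ⟨hV t ht, ?_⟩
  have hsub : ∀ s ∈ J, ∀ t ∈ J, range (ζ s) ⊆ range (ζ t) := fun s hs t ht =>
    range_subset_range_of_normalVelocity_eq_zero hJo hJc hD.smooth
      (fun s hs => (hD.boundary s hs).periodic) (fun s hs => (hD.boundary s hs).deriv_ne_zero) hV
      hs ht
  have hfr : frontier (D t) = frontier (D 0) := by
    rw [← (hD.boundary t ht).range_eq, ← (hD.boundary 0 h0).range_eq]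
    exact (hsub t ht 0 h0).antisymm (hsub 0 h0 t ht)
  have hconn : ∀ s ∈ J, IsPreconnected (interior (D s)) := fun s hs =>
    (hD.domain s hs).simplyConnected.isPathConnected.isConnected.isPreconnected
  have hint : interior (D t) = interior (D 0) :=
    (interior_subset_interior_of_frontier_eq hfr (hconn t ht) (hD.zero_mem t ht)
      (hD.zero_mem 0 h0)).antisymm
    (interior_subset_interior_of_frontier_eq hfr.symm (hconn 0 h0) (hD.zero_mem 0 h0)
      (hD.zero_mem t ht))
  rw [← (hD.domain t ht).closure_interior, hint, (hD.domain 0 h0).closure_interior]
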